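/- A \emph{big two-bar chart} (big 2-BC) $i$ consists of a first bar of height $a_i\in[0,1]$ and a second bar of height $b_i\in[0,1]$ with $\max\{a_i,b_i\}>\frac12$. A \emph{packing} of $n$ big 2-BCs is a map $p:\{1,\dots,n\}\to\{1,\dots,2n-1\}$ such that, when the first bar of every $i$ is put into bin $p(i)$ and its second bar into bin $p(i)+1$, the heights of the bars in each of the bins $1,\dots,2n$ sum to at most $1$. Its \emph{length} $L(p)$ is the number of bins into which at least one bar falls, and $OPT$ is the minimum length of a packing. \emph{Algorithm GALO} sorts the 2-BCs in lexicographically non-increasing order of the pairs $(a_i,b_i)$ and then, starting from the first bin and until all 2-BCs are packed, places into the current bin the first 2-BC of the list (if any) whose first bar still fits there, removes it from the list, and moves to the next bin. \emph{Algorithm Matching} finds a matching $M$ of maximum cardinality in the graph on the 2-BCs in which $i\neq j$ are adjacent iff $a_i+a_j\le1$ and $b_i+b_j\le1$, packs the two 2-BCs of every edge of $M$ together into two consecutive bins, and places the remaining 2-BCs in an arbitrary feasible way. \emph{Algorithm App} returns the shorter of the packing $p^g$ found by GALO and the packing $p^m$ found by Matching. \textbf{Theorem.} For every set of $n$ big 2-BCs,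 every packing $p$ that Algorithm App may return is feasible and satisfies $L(p)\le\frac43\,OPT+\frac23$. Algorithm App can be implemented by a program of a real RAM (with exact addition, subtraction and comparison of real numbers at unit cost) that runs in $O(n^{2.5})$ time. The performance guarantee is tight: there is a set of big 2-BCs, with all bars of positive height, for which $OPT=4$ and this implementation of Algorithm App returns a packing of length $6=\frac43\,OPT+\frac23$. -/

import Mathlib

namespace TwoBar

/-! ## Two-bar charts and their packings -/

/-- An instance of the problem: `n` two-bar charts, chart `i` having a first (left) bar of height
`a i` and a second (right) bar of height `b i`, all heights in `[0, 1]`, such that every chart is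
big, i.e. at least one of its two bars is higher than `1/2`. -/
structure BigCharts (n : ℕ) where
  a : Fin n → ℝ
  b : Fin n → ℝ
  a_nonneg : ∀ i, 0 ≤ a i
  b_nonneg : ∀ i, 0 ≤ b i
  a_le_one : ∀ i, a i ≤ 1
  b_le_one : ∀ i, b i ≤ 1
  big : ∀ i, 1 / 2 < max (a i) (b i)

/-- The length of `p`: the number of bins into which at least one bar falls, where the first bar
of chart `i` falls into bin `p i` and the second one into bin `p i + 1`. -/
def packLength {n : ℕ} (p : Fin n → ℕ) : ℕ :=
  (Finset.univ.image p ∪ Finset.univ.image (fun i => p i + 1)).card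

namespace BigCharts

variable {n : ℕ} (I : BigCharts n)

/-- Feasible packings into the bins `1, …, 2n` of unit capacity. -/
def IsPacking (p : Fin n → ℕ) : Prop :=
  (∀ i, 1 ≤ p i ∧ p i ≤ 2 * n - 1) ∧
    ∀ k ∈ Finset.Icc 1 (2 * n),
      (∑ i with p i = k, I.a i) + (∑ i with p i + 1 = k, I.b i) ≤ 1

/-- The smallest length of a feasible packing. -/
noncomputable def opt : ℕ :=
  sInf {L | ∃ p : Fin n → ℕ, I.IsPacking p ∧ packLength p = L}

/-- Feasible packings exist, so `opt` is a minimum. -/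
theorem exists_isPacking : ∃ p : Fin n → ℕ, I.IsPacking p := by
  refine ⟨fun i => 2 * (i : ℕ) + 1, fun i => ?_, fun k _ => ?_⟩
  · have := i.isLt
    dsimp only
    omega
  · have key : ∀ (f : Fin n → ℝ) (q : Fin n → ℕ), Function.Injective q → (∀ i, f i ≤ 1) →
        ∑ i with q i = k, f i ≤ 1 := by
      intro f q hq hf
      rcases Finset.eq_empty_or_nonempty (Finset.univ.filter fun i => q i = k) with h | ⟨i, hi⟩
      · rw [h]; simp
      · have : (Finset.univ.filter fun i => q i = k) = {i} := by
          ext j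
          simp only [Finset.mem_filter, Finset.mem_univ, true_and, Finset.mem_singleton] at hi ⊢
          exact ⟨fun h => hq (h.trans hi.symm), fun h => h ▸ hi⟩
        rw [this]; simpa using hf i
    have inj1 : Function.Injective fun i : Fin n => 2 * (i : ℕ) + 1 := by
      intro i j h; ext; dsimp only at h; omega
    have inj2 : Function.Injective fun i : Fin n => 2 * (i : ℕ) + 1 + 1 := by
      intro i j h; ext; dsimp only at h; omega
    rcases Nat.even_or_odd k with he | ho
    · rw [Finset.sum_eq_zero (s := Finset.univ.filter fun i : Fin n => 2 * (i : ℕ) + 1 = k)]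
      · simpa using key I.b _ inj2 I.b_le_one
      · intro i hi
        simp only [Finset.mem_filter] at hi
        obtain ⟨m, hm⟩ := he
        omega
    · rw [Finset.sum_eq_zero (s := Finset.univ.filter fun i : Fin n => 2 * (i : ℕ) + 1 + 1 = k)]
      · simpa using key I.a _ inj1 I.a_le_one
      · intro i hi
        simp only [Finset.mem_filter] at hi
        obtain ⟨m, hm⟩ := ho
        omega

/-! ## Algorithm GALO -/

/-- `I.GaloRun k r l p`: the greedy procedure, when the current bin is `k`, the height already
occupied in bin `k` is `r`, bin `k + 1` is empty and `l` is the list of the charts not yet packed,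
gives the charts of `l` the positions prescribed by `p`. In every iteration the first chart of the
list that fits into the current bin, if any, is put there and removed from the list, and the
current bin becomes the next one. (The second bar, of height at most `1`, always fits into the
empty bin `k + 1`.) -/
inductive GaloRun : ℕ → ℝ → List (Fin n) → (Fin n → ℕ) → Prop
  | done (k : ℕ) (r : ℝ) (p : Fin n → ℕ) : GaloRun k r [] p
  | place (k : ℕ) (r : ℝ) (l₁ : List (Fin n)) (i : Fin n) (l₂ : List (Fin n)) (p : Fin n → ℕ) :
      (∀ j ∈ l₁, ¬ r + I.a j ≤ 1) → r + I.a i ≤ 1 → p i = k →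
      GaloRun (k + 1) (I.b i) (l₁ ++ l₂) p → GaloRun k r (l₁ ++ i :: l₂) p
  | next (k : ℕ) (r : ℝ) (l : List (Fin n)) (p : Fin n → ℕ) :
      l ≠ [] → (∀ j ∈ l, ¬ r + I.a j ≤ 1) → GaloRun (k + 1) 0 l p → GaloRun k r l p

/-- In the lexicographic order of the pairs of heights, chart `j` is not greater than chart `i`. -/
def LexGE (i j : Fin n) : Prop :=
  I.a j < I.a i ∨ (I.a j = I.a i ∧ I.b j ≤ I.b i)

/-- `p` is a result of Algorithm GALO: the charts are sorted in lexicographically non-increasing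
order and packed by the greedy procedure from the first bin on. (Only the order of identical
charts is left open.) -/
def IsGalo (p : Fin n → ℕ) : Prop :=
  ∃ l : List (Fin n), l.Perm (List.finRange n) ∧ l.Pairwise I.LexGE ∧ I.GaloRun 1 0 l p

/-! ## Algorithm Matching -/

/-- The graph on the charts in which two different charts are adjacent if they can be packed
together into two consecutive bins. -/
def pairGraph : SimpleGraph (Fin n) where
  Adj i j := i ≠ j ∧ I.a i + I.a j ≤ 1 ∧ I.b i + I.b j ≤ 1
  symm := ⟨fun i j h => ⟨h.1.symm, by linarith [h.2.1], by linarith [h.2.2]⟩⟩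
  loopless := ⟨fun _ h => h.1 rfl⟩

/-- `p` is a result of Algorithm Matching: a feasible packing in which, for some matching `M` of
maximum cardinality, the two charts of each edge of `M` are packed together into two consecutive
bins; the remaining charts are placed in any feasible way. -/
def IsMatchingPacking (p : Fin n → ℕ) : Prop :=
  I.IsPacking p ∧ ∃ M : I.pairGraph.Subgraph, M.IsMatching ∧
    (∀ M' : I.pairGraph.Subgraph, M'.IsMatching → M'.edgeSet.ncard ≤ M.edgeSet.ncard) ∧
    ∀ i j, M.Adj i j → p i = p j

/-! ## Algorithm App -/

/-- `p` is a result of Algorithm App: the better one of a result of Algorithm GALO and a result of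
Algorithm Matching. -/
def IsApp (p : Fin n → ℕ) : Prop :=
  ∃ pg pm : Fin n → ℕ, I.IsGalo pg ∧ I.IsMatchingPacking pm ∧ (p = pg ∨ p = pm) ∧
    packLength p = min (packLength pg) (packLength pm)

end BigCharts

/-! ## The machine model: a real RAM

A program is a fixed structured program (`Cmd`) over variables and arrays that hold natural numbers
or real numbers; variables and arrays have fixed names in the program, array indices are computed.
Every assignment and every evaluation of a condition costs one step (the expressions have a size
fixed by the program, so counting their operations would change the cost by a constant factor
only). The natural numbers serve as indices and counters, and the only arithmetic on them is
adding or subtracting one, so no long number can be built in few steps; on real numbers there are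
addition, subtraction and exact comparison, and there is no rounding of reals to integers. -/

/-- Contents of the memory: natural variables, natural arrays, real variables, real arrays. -/
structure Mem where
  nvar : ℕ → ℕ
  narr : ℕ → ℕ → ℕ
  rvar : ℕ → ℝ
  rarr : ℕ → ℕ → ℝ

/-- Expressions with natural values. -/
inductive NExp
  | const (c : ℕ)
  | var (x : ℕ)
  | arr (A : ℕ) (e : NExp)
  | succ (e : NExp)
  | pred (e : NExp)

/-- Expressions with real values. -/
inductive RExp
  | const (q : ℚ)
  | var (x : ℕ)
  | arr (A : ℕ) (e : NExp)
  | add (e f : RExp)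
  | sub (e f : RExp)

/-- Conditions. -/
inductive BExp
  | nle (e f : NExp)
  | rle (e f : RExp)
  | not (c : BExp)
  | and (c d : BExp)

/-- Value of a natural expression. -/
def NExp.eval (s : Mem) : NExp → ℕ
  | const c => c
  | var x => s.nvar x
  | arr A e => s.narr A (e.eval s)
  | succ e => e.eval s + 1
  | pred e => e.eval s - 1

/-- Value of a real expression. -/
noncomputable def RExp.eval (s : Mem) : RExp → ℝ
  | const q => (q : ℝ)
  | var x => s.rvar x
  | arr A e => s.rarr A (e.eval s)
  | add e f => e.eval s + f.eval s
  | sub e f => e.eval s - f.eval s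

/-- Truth of a condition. -/
def BExp.Holds (s : Mem) : BExp → Prop
  | nle e f => e.eval s ≤ f.eval s
  | rle e f => e.eval s ≤ f.eval s
  | not c => ¬ c.Holds s
  | and c d => c.Holds s ∧ d.Holds s

/-- Programs. -/
inductive Cmd
  | skip
  | setN (x : ℕ) (e : NExp)
  | storeN (A : ℕ) (i e : NExp)
  | setR (x : ℕ) (e : RExp)
  | storeR (A : ℕ) (i : NExp) (e : RExp)
  | seq (c d : Cmd)
  | ite (t : BExp) (c d : Cmd)
  | loop (t : BExp) (c : Cmd)

/-- `Run c s t s'`: program `c`, started in memory `s`, halts after exactly `t` steps in memory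
`s'` (`loop t c` repeats `c` while the condition `t` holds). -/
inductive Run : Cmd → Mem → ℕ → Mem → Prop
  | skip (s : Mem) : Run Cmd.skip s 1 s
  | setN (x : ℕ) (e : NExp) (s : Mem) :
      Run (Cmd.setN x e) s 1 { s with nvar := Function.update s.nvar x (e.eval s) }
  | storeN (A : ℕ) (i e : NExp) (s : Mem) :
      Run (Cmd.storeN A i e) s 1
        { s with narr :=
            Function.update s.narr A (Function.update (s.narr A) (i.eval s) (e.eval s)) }
  | setR (x : ℕ) (e : RExp) (s : Mem) :
      Run (Cmd.setR x e) s 1 { s with rvar := Function.update s.rvar x (e.eval s) }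
  | storeR (A : ℕ) (i : NExp) (e : RExp) (s : Mem) :
      Run (Cmd.storeR A i e) s 1
        { s with rarr :=
            Function.update s.rarr A (Function.update (s.rarr A) (i.eval s) (e.eval s)) }
  | seq {c d : Cmd} {s s₁ s₂ : Mem} {t₁ t₂ : ℕ} :
      Run c s t₁ s₁ → Run d s₁ t₂ s₂ → Run (Cmd.seq c d) s (t₁ + t₂) s₂
  | iteTrue {b : BExp} {c d : Cmd} {s s₁ : Mem} {t : ℕ} :
      b.Holds s → Run c s t s₁ → Run (Cmd.ite b c d) s (t + 1) s₁
  | iteFalse {b : BExp} {c d : Cmd} {s s₁ : Mem} {t : ℕ} :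
      ¬ b.Holds s → Run d s t s₁ → Run (Cmd.ite b c d) s (t + 1) s₁
  | loopTrue {b : BExp} {c : Cmd} {s s₁ s₂ : Mem} {t₁ t₂ : ℕ} :
      b.Holds s → Run c s t₁ s₁ → Run (Cmd.loop b c) s₁ t₂ s₂ →
      Run (Cmd.loop b c) s (t₁ + t₂ + 1) s₂
  | loopFalse {b : BExp} {c : Cmd} {s : Mem} :
      ¬ b.Holds s → Run (Cmd.loop b c) s 1 s

/-- The machine is deterministic: step count and final memory are determined by the program and
the initial memory. -/
theorem Run.deterministic {c : Cmd} {s s₁ s₂ : Mem} {t₁ t₂ : ℕ}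
    (h₁ : Run c s t₁ s₁) (h₂ : Run c s t₂ s₂) : t₁ = t₂ ∧ s₁ = s₂ := by
  induction h₁ generalizing t₂ s₂ with
  | skip => cases h₂; exact ⟨rfl, rfl⟩
  | setN => cases h₂; exact ⟨rfl, rfl⟩
  | storeN => cases h₂; exact ⟨rfl, rfl⟩
  | setR => cases h₂; exact ⟨rfl, rfl⟩
  | storeR => cases h₂; exact ⟨rfl, rfl⟩
  | seq _ _ ih₁ ih₂ =>
    cases h₂ with
    | seq g₁ g₂ =>
      obtain ⟨rfl, rfl⟩ := ih₁ g₁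
      obtain ⟨rfl, rfl⟩ := ih₂ g₂
      exact ⟨rfl, rfl⟩
  | iteTrue hb _ ih =>
    cases h₂ with
    | iteTrue _ g => obtain ⟨rfl, rfl⟩ := ih g; exact ⟨rfl, rfl⟩
    | iteFalse hb' _ => exact absurd hb hb'
  | iteFalse hb _ ih =>
    cases h₂ with
    | iteTrue hb' _ => exact absurd hb' hb
    | iteFalse _ g => obtain ⟨rfl, rfl⟩ := ih g; exact ⟨rfl, rfl⟩
  | loopTrue hb _ _ ih₁ ih₂ =>
    cases h₂ with
    | loopTrue _ g₁ g₂ =>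
      obtain ⟨rfl, rfl⟩ := ih₁ g₁
      obtain ⟨rfl, rfl⟩ := ih₂ g₂
      exact ⟨rfl, rfl⟩
    | loopFalse hb' => exact absurd hb hb'
  | loopFalse hb =>
    cases h₂ with
    | loopTrue hb' _ _ => exact absurd hb' hb
    | loopFalse _ => exact ⟨rfl, rfl⟩

/-- The initial memory on input `I`: natural variable `0` holds the number `n` of charts, the real
arrays `0` and `1` hold the heights of the first and of the second bars (at the indices
`0, …, n - 1`), and everything else is zero. -/
noncomputable def BigCharts.inputMem {n : ℕ} (I : BigCharts n) : Mem where
  nvar x := if x = 0 then n else 0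
  narr _ _ := 0
  rvar _ := 0
  rarr A i :=
    if h : i < n then (if A = 0 then I.a ⟨i, h⟩ else if A = 1 then I.b ⟨i, h⟩ else 0) else 0

/-- The packing written by a program into the natural array `0`. -/
def Mem.output (s : Mem) (n : ℕ) : Fin n → ℕ := fun i => s.narr 0 i

end TwoBar

namespace TwoBar

/-! ## Lengths of packings and matchings -/

/-! Let `q` be an optimal packing and `x` the number of distinct positions it uses. Charts at a
common position are adjacent, and never three of them, since among three big charts two are high on
the same side. So `q` contains a matching with at least `n - x` edges, a maximum matching is no
smaller, and Matching needs at most `2 * x` bins (`IsMatchingPacking.packLength_add_le`).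

GALO never repeats a position, so its length is `n` plus the number of its blocks of consecutive
positions. `IsGalo.exists_deficiency` turns the blocks into an obstruction: a threshold `α` for
which the charts with `b > 1 - α` outnumber those with `a < α` by at least the number of blocks
minus one. In any packing this surplus forces bins that hold only one kind of bar
(`IsPacking.card_image_add_le`), so `OPT` is at least `x` plus the surplus. Since also `n ≤ OPT`,
GALO needs at most `2 * OPT + 1 - x` bins. Twice this bound plus `2 * x` is `4 * OPT + 2`, which is
therefore at least three times the shorter length.

The implementation needs no general matching algorithm: pairing the highest second bar with the
adjacent chart of highest first bar is optimal by an exchange argument (`IsPartner.exchange`). GALO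
finds each next chart by a linear search instead of sorting. Both take quadratic time
(`appProg_ends`). -/

theorem packLength_eq_card_add_ends {n : ℕ} (p : Fin n → ℕ) :
    packLength p = (Finset.univ.image p).card +
      (Finset.univ.image (fun i => p i + 1) \ Finset.univ.image p).card := by
  rw [packLength, ← Finset.union_sdiff_self_eq_union,
    Finset.card_union_of_disjoint Finset.disjoint_sdiff]

theorem card_image_succ {n : ℕ} (p : Fin n → ℕ) :
    (Finset.univ.image (fun i => p i + 1)).card = (Finset.univ.image p).card := by
  have : Finset.univ.image (fun i => p i + 1) = (Finset.univ.image p).image (· + 1) := by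
    rw [Finset.image_image]; rfl
  rw [this, Finset.card_image_of_injective _ (add_left_injective 1)]

/-- Mirror image of `packLength_eq_card_add_ends`: the extra bins counted are those with a first but
no second bar, instead of those with a second but no first bar. The lower bound uses one or the
other according to the threshold. -/
theorem packLength_eq_card_add_starts {n : ℕ} (p : Fin n → ℕ) :
    packLength p = (Finset.univ.image p).card +
      (Finset.univ.image p \ Finset.univ.image (fun i => p i + 1)).card := by
  rw [packLength, Finset.union_comm, ← Finset.union_sdiff_self_eq_union,
    Finset.card_union_of_disjoint Finset.disjoint_sdiff, card_image_succ]

theorem packLength_le_two_mul_card_image {n : ℕ} (p : Fin n → ℕ) :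
    packLength p ≤ 2 * (Finset.univ.image p).card := by
  have := Finset.card_union_le (Finset.univ.image p) (Finset.univ.image (fun i => p i + 1))
  rw [card_image_succ] at this
  rw [packLength]
  omega

theorem packLength_of_odd {n : ℕ} {p : Fin n → ℕ} (hp : ∀ i, Odd (p i)) :
    packLength p = 2 * (Finset.univ.image p).card := by
  rw [packLength, Finset.card_union_of_disjoint, card_image_succ, two_mul]
  rw [Finset.disjoint_left]
  intro k hk hk'
  simp only [Finset.mem_image, Finset.mem_univ, true_and] at hk hk'
  obtain ⟨i, rfl⟩ := hk
  obtain ⟨j, hj⟩ := hk'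
  have h1 := hp i
  have h2 := hp j
  grind

namespace BigCharts

variable {n : ℕ} {I : BigCharts n} {p : Fin n → ℕ}

theorem half_lt_or (I : BigCharts n) (i : Fin n) : 1 / 2 < I.a i ∨ 1 / 2 < I.b i :=
  lt_max_iff.1 (I.big i)

theorem sum_nonneg_of_a (I : BigCharts n) (s : Finset (Fin n)) : 0 ≤ ∑ i ∈ s, I.a i :=
  Finset.sum_nonneg fun i _ => I.a_nonneg i

theorem sum_nonneg_of_b (I : BigCharts n) (s : Finset (Fin n)) : 0 ≤ ∑ i ∈ s, I.b i :=
  Finset.sum_nonneg fun i _ => I.b_nonneg i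

theorem IsPacking.adj (hp : I.IsPacking p) {i j : Fin n} (hij : i ≠ j) (h : p i = p j) :
    I.pairGraph.Adj i j := by
  have hb := hp.1 i
  refine ⟨hij, ?_, ?_⟩
  · have h1 := hp.2 (p i) (by simp; omega)
    have h2 : ∑ x ∈ {i, j}, I.a x ≤ ∑ x with p x = p i, I.a x :=
      Finset.sum_le_sum_of_subset_of_nonneg
        (by intro x; simp; rintro (rfl | rfl); exacts [rfl, h.symm]) fun x _ _ => I.a_nonneg x
    rw [Finset.sum_pair hij] at h2
    linarith [I.sum_nonneg_of_b (Finset.univ.filter fun x => p x + 1 = p i)]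
  · have h1 := hp.2 (p i + 1) (by simp; omega)
    have h2 : ∑ x ∈ {i, j}, I.b x ≤ ∑ x with p x + 1 = p i + 1, I.b x :=
      Finset.sum_le_sum_of_subset_of_nonneg
        (by intro x; simp; rintro (rfl | rfl); exacts [rfl, h.symm]) fun x _ _ => I.b_nonneg x
    rw [Finset.sum_pair hij] at h2
    linarith [I.sum_nonneg_of_a (Finset.univ.filter fun x => p x = p i + 1)]

theorem IsPacking.chain (hp : I.IsPacking p) {i j : Fin n} (h : p i + 1 = p j) :
    I.b i + I.a j ≤ 1 := by
  have hb := hp.1 j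
  have h1 := hp.2 (p j) (by simp; omega)
  have h2 : I.a j ≤ ∑ x with p x = p j, I.a x :=
    Finset.single_le_sum (fun x _ => I.a_nonneg x) (by simp)
  have h3 : I.b i ≤ ∑ x with p x + 1 = p j, I.b x :=
    Finset.single_le_sum (fun x _ => I.b_nonneg x) (by simp [h])
  linarith

/-- Each chart is charged to the bin of one of its bars higher than `1/2`; no bin holds two such
bars. -/
theorem IsPacking.card_le_packLength (hp : I.IsPacking p) : n ≤ packLength p := by
  have := Finset.card_le_card_of_injOn (s := (Finset.univ : Finset (Fin n)))
    (t := Finset.univ.image p ∪ Finset.univ.image (fun i => p i + 1))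
    (fun i => if 1 / 2 < I.a i then p i else p i + 1) ?_ ?_
  · simpa [packLength] using this
  · intro i _
    dsimp only
    split_ifs <;> simp
  · intro i _ j _ hij
    by_contra hne
    dsimp only at hij
    have hi := I.half_lt_or i
    have hj := I.half_lt_or j
    split_ifs at hij with h1 h2 h2
    · linarith [(hp.adj hne hij).2.1]
    · have := hp.chain hij.symm
      rcases hj with h | h <;> first | contradiction | linarith
    · have := hp.chain hij
      rcases hi with h | h <;> first | contradiction | linarith
    · have := (hp.adj hne (Nat.succ_injective hij)).2.2
      rcases hi with h | h <;> rcases hj with h' | h' <;> first | contradiction | linarith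

/-- No three charts are pairwise adjacent. -/
theorem pairGraph_adj_unique {i j k : Fin n} (hij : I.pairGraph.Adj i j)
    (hik : I.pairGraph.Adj i k) (hjk : j ≠ k → I.pairGraph.Adj j k) : j = k := by
  by_contra h
  have h3 := (hjk h).2
  have h1 := hij.2
  have h2 := hik.2
  -- Two of the three charts exceed `1/2` on the same side, so these two cannot be adjacent.
  rcases I.half_lt_or i with hi | hi <;> rcases I.half_lt_or j with hj | hj <;>
    rcases I.half_lt_or k with hk | hk <;> linarith

/-- The charts that share their position with another one, when these are adjacent. -/
def pairing (I : BigCharts n) (p : Fin n → ℕ)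
    (h : ∀ i j, i ≠ j → p i = p j → I.pairGraph.Adj i j) : I.pairGraph.Subgraph where
  verts := {i | ∃ j, i ≠ j ∧ p i = p j}
  Adj i j := i ≠ j ∧ p i = p j
  adj_sub h' := h _ _ h'.1 h'.2
  edge_vert h' := ⟨_, h'⟩
  symm := ⟨fun _ _ h' => ⟨h'.1.symm, h'.2.symm⟩⟩

theorem pairing_isMatching (h : ∀ i j, i ≠ j → p i = p j → I.pairGraph.Adj i j) :
    (I.pairing p h).IsMatching := by
  rintro i ⟨j, hij, hp⟩
  refine ⟨j, ⟨hij, hp⟩, ?_⟩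
  rintro k ⟨hik, hp'⟩
  exact pairGraph_adj_unique (h i k hik hp') (h i j hij hp)
    fun hne => h k j hne (hp'.symm.trans hp)

/-- The charts with the lowest number at their position have distinct positions; every other chart
contributes an edge of its own. -/
theorem card_le_card_image_add_pairing
    (h : ∀ i j, i ≠ j → p i = p j → I.pairGraph.Adj i j) :
    n ≤ (Finset.univ.image p).card + (I.pairing p h).edgeSet.ncard := by
  classical
  set S : Finset (Fin n) := {i | ∃ j, j < i ∧ p j = p i} with hS
  have h1 : Sᶜ.card ≤ (Finset.univ.image p).card := by
    refine Finset.card_le_card_of_injOn p (fun i _ => by simp) ?_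
    intro i hi j hj hij
    simp only [hS, Finset.coe_compl, Set.mem_compl_iff, Finset.mem_coe, Finset.mem_filter,
      Finset.mem_univ, true_and, not_exists, not_and] at hi hj
    rcases lt_trichotomy i j with hlt | rfl | hlt
    · exact absurd hij (hj i hlt)
    · rfl
    · exact absurd hij.symm (hi j hlt)
  have h2 : ∀ i ∈ S, ∃ j, j < i ∧ p j = p i := fun i hi => by simpa [hS] using hi
  choose! f hf hf' using h2
  have h3 : S.card ≤ (I.pairing p h).edgeSet.ncard := by
    rw [← Set.ncard_coe_finset]
    refine Set.ncard_le_ncard_of_injOn (fun i => s(f i, i)) ?_ ?_ (Set.toFinite _)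
    · intro i hi
      exact ⟨(hf i hi).ne, hf' i hi⟩
    · intro i hi j hj hij
      have h4 := hf i hi
      have h5 := hf j hj
      simp only [Sym2.eq_iff] at hij
      rcases hij with ⟨_, h6⟩ | ⟨h6, h7⟩
      · exact h6
      · rw [h6] at h4
        rw [← h7] at h5
        exact absurd h4 h5.asymm
  have := Finset.card_compl_add_card S
  rw [Fintype.card_fin] at this
  omega

theorem ncard_edgeSet_le {M : I.pairGraph.Subgraph} (hM : M.IsMatching) (S : Finset (Fin n))
    (hS : ∀ i j, i < j → M.Adj i j → j ∈ S) : M.edgeSet.ncard ≤ S.card := by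
  classical
  have : M.edgeSet ⊆ (fun i => s(i, if h : i ∈ M.verts then (hM h).choose else i)) '' S := by
    intro e
    induction e with | _ x y
    have key : ∀ x y, M.Adj x y → x < y →
        s(x, y) ∈ (fun i => s(i, if h : i ∈ M.verts then (hM h).choose else i)) '' S := by
      intro x y h hlt
      refine ⟨y, hS x y hlt h, ?_⟩
      have hy := h.symm.fst_mem
      have := (hM hy).choose_spec.2 x h.symm
      simp only [hy, ↓reduceDIte, ← this, Sym2.eq_swap]
    intro h
    rcases lt_trichotomy x y with hlt | rfl | hlt
    · exact key x y h hlt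
    · exact absurd rfl (M.adj_sub h).ne
    · rw [Sym2.eq_swap]
      exact key y x (M.symm.symm _ _ h) hlt
  calc M.edgeSet.ncard ≤ _ := Set.ncard_le_ncard this (Set.toFinite _)
    _ ≤ (S : Set (Fin n)).ncard := Set.ncard_image_le (Set.toFinite _)
    _ = S.card := Set.ncard_coe_finset S

/-- The larger ends of the edges of `M` add no new positions, so each edge saves at least one. -/
theorem card_image_add_ncard_le {M : I.pairGraph.Subgraph} (hM : M.IsMatching)
    (hp : ∀ i j, M.Adj i j → p i = p j) :
    (Finset.univ.image p).card + M.edgeSet.ncard ≤ n := by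
  classical
  set S : Finset (Fin n) := {j | ∃ i, i < j ∧ M.Adj i j} with hS
  have h1 := ncard_edgeSet_le hM S fun i j hij h =>
    Finset.mem_filter.2 ⟨Finset.mem_univ j, i, hij, h⟩
  have h2 : Finset.univ.image p ⊆ Sᶜ.image p := by
    intro k hk
    obtain ⟨i, -, rfl⟩ := Finset.mem_image.1 hk
    by_cases hi : i ∈ S
    · obtain ⟨j, hj, hji⟩ : ∃ j, j < i ∧ M.Adj j i := by simpa [hS] using hi
      refine Finset.mem_image.2 ⟨j, ?_, hp _ _ hji⟩
      simp only [hS, Finset.mem_compl, Finset.mem_filter, Finset.mem_univ, true_and, not_exists,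
        not_and]
      intro k hk hkj
      have := (hM hji.fst_mem).unique hji hkj.symm
      subst this
      exact absurd hj hk.asymm
    · exact Finset.mem_image_of_mem _ (by simpa using hi)
  have h3 := (Finset.card_le_card h2).trans Finset.card_image_le
  have := Finset.card_compl_add_card S
  rw [Fintype.card_fin] at this
  omega

/-! ## Results of Algorithm GALO -/

/-- What Algorithm GALO guarantees about the positions `p` of the charts of `l`, when it starts
from bin `k` filled up to height `r`. -/
structure GaloSpec (I : BigCharts n) (k : ℕ) (r : ℝ) (l : List (Fin n)) (p : Fin n → ℕ) :
    Prop where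
  le : ∀ i ∈ l, k ≤ p i
  lt : ∀ i ∈ l, p i + 1 ≤ k + 2 * l.length
  lt_of_zero : r = 0 → ∀ i ∈ l, p i + 2 ≤ k + 2 * l.length
  inj : ∀ i ∈ l, ∀ j ∈ l, p i = p j → i = j
  fits : ∀ i ∈ l, p i = k → r + I.a i ≤ 1
  chain : ∀ i ∈ l, ∀ j ∈ l, p j = p i + 1 → I.b i + I.a j ≤ 1
  first : ∀ j ∈ l, k < p j → r + I.a j ≤ 1 → ∃ f ∈ l, p f = k ∧ I.a j ≤ I.a f
  next : ∀ i ∈ l, ∀ j ∈ l, p i + 1 < p j → I.b i + I.a j ≤ 1 →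
    ∃ f ∈ l, p f = p i + 1 ∧ I.a j ≤ I.a f
  start : ∀ f ∈ l, ∀ j ∈ l, (p f = k → r = 0) → (∀ i ∈ l, p i + 1 ≠ p f) → p f < p j →
    I.a j ≤ I.a f

/-- The first chart that fits has the highest first bar among those that fit; sorting by first bars
alone is enough for this. -/
theorem GaloRun.spec {k : ℕ} {r : ℝ} {l : List (Fin n)} (h : I.GaloRun k r l p)
    (hl : l.Pairwise fun i j => I.a j ≤ I.a i) : I.GaloSpec k r l p := by
  induction h with
  | done k r p => constructor <;> simp
  | next k r l p hne hno _ ih =>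
    have ih := ih hl
    -- An empty bin accepts every chart, so two successive bins are never skipped. This gives the
    -- bounds `lt` and `lt_of_zero`, the latter saving one bin.
    have hr : r ≠ 0 := by
      rintro rfl
      obtain ⟨x, hx⟩ := List.exists_mem_of_ne_nil l hne
      exact hno x hx (by simpa using I.a_le_one x)
    constructor
    · intro i hi; have := ih.le i hi; omega
    · intro i hi; have := ih.lt_of_zero rfl i hi; omega
    · intro h0; exact absurd h0 hr
    · exact ih.inj
    · intro i hi hk; have := ih.le i hi; omega
    · exact ih.chain
    · intro j hj _ h; exact absurd h (hno j hj)
    · exact ih.next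
    · intro f hf j hj _; exact ih.start f hf j hj fun _ => rfl
  | place k r l₁ i l₂ p hno hi hpi _ ih =>
    have hl' : (l₁ ++ l₂).Pairwise fun i j => I.a j ≤ I.a i :=
      hl.sublist (by simp)
    have ih := ih hl'
    have mem : ∀ {x}, x ∈ l₁ ++ i :: l₂ → x = i ∨ x ∈ l₁ ++ l₂ := by
      intro x; simp only [List.mem_append, List.mem_cons]; tauto
    have mem' : ∀ {x}, x ∈ l₁ ++ l₂ → x ∈ l₁ ++ i :: l₂ := by
      intro x; simp only [List.mem_append, List.mem_cons]; tauto
    have memi : i ∈ l₁ ++ i :: l₂ := by simp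
    have hle : ∀ j ∈ l₁ ++ l₂, r + I.a j ≤ 1 → I.a j ≤ I.a i := by
      intro j hj hr
      rcases List.mem_append.1 hj with h | h
      · exact absurd hr (hno j h)
      · exact List.rel_of_pairwise_cons (List.pairwise_append.1 hl).2.1 h
    have hlen : (l₁ ++ i :: l₂).length = (l₁ ++ l₂).length + 1 := by
      simp only [List.length_append, List.length_cons]; omega
    constructor
    · intro x hx
      rcases mem hx with rfl | hx
      · exact hpi.ge
      · have := ih.le x hx; omega
    · intro x hx
      rcases mem hx with rfl | hx
      · omega
      · have := ih.lt x hx; omega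
    · intro _ x hx
      rcases mem hx with rfl | hx
      · omega
      · have := ih.lt x hx; omega
    · intro x hx y hy hxy
      rcases mem hx with rfl | hx' <;> rcases mem hy with rfl | hy'
      · rfl
      · have := ih.le y hy'; omega
      · have := ih.le x hx'; omega
      · exact ih.inj x hx' y hy' hxy
    · intro x hx hk
      rcases mem hx with rfl | hx
      · exact hi
      · have := ih.le x hx; omega
    · intro x hx y hy hxy
      rcases mem hx with rfl | hx' <;> rcases mem hy with rfl | hy'
      · omega
      · exact ih.fits y hy' (by omega)
      · have := ih.le x hx'; omega
      · exact ih.chain x hx' y hy' hxy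
    · intro j hj hk hr
      rcases mem hj with rfl | hj
      · omega
      · exact ⟨i, memi, hpi, hle j hj hr⟩
    · intro x hx y hy hxy hr
      rcases mem hx with rfl | hx' <;> rcases mem hy with rfl | hy'
      · omega
      · obtain ⟨f, hf, h1, h2⟩ := ih.first y hy' (by omega) hr
        exact ⟨f, mem' hf, by omega, h2⟩
      · have := ih.le x hx'; omega
      · obtain ⟨f, hf, h⟩ := ih.next x hx' y hy' hxy hr
        exact ⟨f, mem' hf, h⟩
    · intro f hf j hj h0 hs hfj
      rcases mem hf with rfl | hf' <;> rcases mem hj with rfl | hj'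
      · exact le_rfl
      · refine hle j hj' ?_
        rw [h0 hpi, zero_add]
        exact I.a_le_one j
      · have := ih.le f hf'; omega
      · refine ih.start f hf' j hj' (fun h => ?_) (fun x hx => hs x (mem' hx)) hfj
        exact absurd (by omega) (hs i memi)

theorem sum_filter_eq_of_injective {q : Fin n → ℕ} (hq : Function.Injective q) (f : Fin n → ℝ)
    (k : ℕ) : (∑ i with q i = k, f i = 0 ∧ ∀ i, q i ≠ k) ∨
      ∃ i, q i = k ∧ ∑ i with q i = k, f i = f i := by
  by_cases h : ∃ i, q i = k
  · obtain ⟨i, hi⟩ := h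
    refine Or.inr ⟨i, hi, ?_⟩
    have : (Finset.univ.filter fun j => q j = k) = {i} := by
      ext j
      simp only [Finset.mem_filter, Finset.mem_univ, true_and, Finset.mem_singleton]
      exact ⟨fun h => hq (h.trans hi.symm), fun h => h ▸ hi⟩
    rw [this, Finset.sum_singleton]
  · push Not at h
    refine Or.inl ⟨?_, h⟩
    rw [Finset.filter_false_of_mem fun i _ => h i, Finset.sum_empty]

theorem IsGalo.exists_spec (hp : I.IsGalo p) :
    ∃ l : List (Fin n), (∀ i, i ∈ l) ∧ l.length = n ∧ I.GaloSpec 1 0 l p := by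
  obtain ⟨l, hl, hs, hr⟩ := hp
  refine ⟨l, fun i => hl.mem_iff.2 (List.mem_finRange i), by simpa using hl.length_eq, ?_⟩
  exact hr.spec (hs.imp fun h => h.elim (fun h => h.le) fun h => h.1.le)

theorem IsGalo.injective (hp : I.IsGalo p) : Function.Injective p := by
  obtain ⟨l, hl, -, h⟩ := hp.exists_spec
  exact fun i j hij => h.inj i (hl i) j (hl j) hij

theorem IsGalo.isPacking (hp : I.IsGalo p) : I.IsPacking p := by
  obtain ⟨l, hl, hn, h⟩ := hp.exists_spec
  refine ⟨fun i => ⟨h.le i (hl i), ?_⟩, fun k _ => ?_⟩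
  · have := h.lt_of_zero rfl i (hl i)
    omega
  · have inj := hp.injective
    have inj' : Function.Injective fun i => p i + 1 := fun i j hij => inj (Nat.succ_injective hij)
    rcases sum_filter_eq_of_injective inj I.a k with ⟨h1, -⟩ | ⟨i, hi, h1⟩ <;>
      rcases sum_filter_eq_of_injective inj' I.b k with ⟨h2, -⟩ | ⟨j, hj, h2⟩ <;> rw [h1, h2]
    · norm_num
    · simpa using I.b_le_one j
    · simpa using I.a_le_one i
    · have := h.chain j (hl j) i (hl i) (by omega)
      linarith

/-- A deficient family of second bars: if `c` is the number of maximal blocks of consecutive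
positions used by GALO, then for some height `α` the charts whose second bar is higher than `1 - α`
outnumber those whose first bar is lower than `α` by at least `c - 1`. -/
theorem IsGalo.exists_deficiency (hp : I.IsGalo p) [NeZero n] :
    ∃ α : ℝ, packLength p + (Finset.univ.filter fun i => I.a i < α).card ≤
      n + 1 + (Finset.univ.filter fun i => 1 - α < I.b i).card := by
  classical
  obtain ⟨l, hl, hn, h⟩ := hp.exists_spec
  have inj := hp.injective
  obtain ⟨last, -, hlast⟩ := Finset.exists_max_image (Finset.univ : Finset (Fin n)) p
    Finset.univ_nonempty
  -- `E` collects the last charts of all blocks but the final one.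
  set E : Finset (Fin n) := {e | (∃ j, p e < p j) ∧ ∀ j, p j ≠ p e + 1} with hE
  have hEmem : ∀ {e}, e ∈ E ↔ (∃ j, p e < p j) ∧ ∀ j, p j ≠ p e + 1 := by simp [hE]
  have hlen : packLength p ≤ n + (E.card + 1) := by
    rw [packLength_eq_card_add_ends, Finset.card_image_of_injective _ inj, Finset.card_univ,
      Fintype.card_fin]
    have : Finset.univ.image (fun i => p i + 1) \ Finset.univ.image p ⊆
        (insert last E).image (fun i => p i + 1) := by
      intro k hk
      simp only [Finset.mem_sdiff, Finset.mem_image, Finset.mem_univ, true_and, not_exists] at hk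
      obtain ⟨⟨i, rfl⟩, hk⟩ := hk
      refine Finset.mem_image_of_mem _ ?_
      rw [Finset.mem_insert]
      by_cases hi : i = last
      · exact Or.inl hi
      · refine Or.inr (hEmem.2 ⟨⟨last, ?_⟩, hk⟩)
        exact lt_of_le_of_ne (hlast i (Finset.mem_univ i)) fun h' => hi (inj h')
    have := (Finset.card_le_card this).trans
      (Finset.card_image_le.trans (Finset.card_insert_le _ _))
    omega
  -- The charts behind all of `E` form the final block; `α` is the lowest first bar in it, attained
  -- by `m`.
  have hZ : (Finset.univ.filter fun j => ∀ e ∈ E, p e < p j).Nonempty := by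
    refine ⟨last, Finset.mem_filter.2 ⟨Finset.mem_univ _, fun e he => ?_⟩⟩
    obtain ⟨⟨j, hj⟩, -⟩ := hEmem.1 he
    exact hj.trans_le (hlast j (Finset.mem_univ j))
  obtain ⟨m, hm, hmin⟩ := Finset.exists_min_image _ I.a hZ
  simp only [Finset.mem_filter, Finset.mem_univ, true_and] at hm hmin
  refine ⟨I.a m, ?_⟩
  set F : Finset (Fin n) := {i | I.a i < I.a m} with hF
  set H : Finset (Fin n) := {i | 1 - I.a m < I.b i} with hH
  -- By minimality of `m`, a chart `f` with a lower first bar lies before `m`. It cannot start a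
  -- block, as an empty bin takes the highest remaining first bar. So it follows a chart whose
  -- second bar left no room for `m`.
  have pred : ∀ f ∈ F, ∃ i, p i + 1 = p f ∧ i ∈ H := by
    intro f hf
    have hf : I.a f < I.a m := by simpa [hF] using hf
    have hlt : p f < p m := by
      rcases lt_trichotomy (p f) (p m) with h' | h' | h'
      · exact h'
      · rw [inj h'] at hf; exact absurd hf (lt_irrefl _)
      · exact absurd (hmin f fun e he => (hm e he).trans h') hf.not_ge
    by_contra hno
    push Not at hno
    by_cases hs : ∃ i, p i + 1 = p f
    · obtain ⟨i, hi⟩ := hs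
      have hiH : I.b i + I.a m ≤ 1 := by
        have := hno i hi
        simp only [hH, Finset.mem_filter, Finset.mem_univ, true_and] at this
        linarith
      obtain ⟨g, -, hg, hg'⟩ := h.next i (hl i) m (hl m) (by omega) hiH
      rw [inj (hg.trans hi)] at hg'
      linarith
    · push Not at hs
      have := h.start f (hl f) m (hl m) (fun _ => rfl) (fun i _ => hs i) hlt
      linarith
  choose! g hg hgH using pred
  -- No chart follows an end in `E`, so `m` did not fit there either. These ends differ from the
  -- predecessors `g f`, which are followed by `f`.
  have hsub : F.image g ∪ E ⊆ H := by
    intro x hx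
    rcases Finset.mem_union.1 hx with hx | hx
    · obtain ⟨f, hf, rfl⟩ := Finset.mem_image.1 hx
      exact hgH f hf
    · simp only [hH, Finset.mem_filter, Finset.mem_univ, true_and]
      by_contra hno
      have hxm := hm x hx
      have hne := (hEmem.1 hx).2
      obtain ⟨f, -, hf, -⟩ := h.next x (hl x) m (hl m)
        (lt_of_le_of_ne hxm (hne m).symm) (by linarith)
      exact hne f hf
  have hdisj : Disjoint (F.image g) E := by
    rw [Finset.disjoint_left]
    intro x hx hxE
    obtain ⟨f, hf, rfl⟩ := Finset.mem_image.1 hx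
    exact (hEmem.1 hxE).2 f (hg f hf).symm
  have hcard : (F.image g).card = F.card := by
    refine Finset.card_image_of_injOn fun x hx y hy hxy => inj ?_
    rw [← hg x hx, ← hg y hy, hxy]
  have := Finset.card_le_card hsub
  rw [Finset.card_union_of_disjoint hdisj, hcard] at this
  omega

/-! ## The lower bound on the length of packings -/

/-- For `α ≤ 1/2` the second bars above `1 - α` lie in distinct bins, and a first bar joining one of
them is below `α`; so at least `|H| - |F|` bins hold no first bar. For `α > 1/2` the first bars of
height at least `α` lie in distinct bins, and a second bar joining one is at most `1 - α`; so at
least `|Fᶜ| - |Hᶜ| = |H| - |F|` bins hold no second bar. -/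
theorem IsPacking.card_image_add_le (hp : I.IsPacking p) (α : ℝ) :
    (Finset.univ.image p).card + (Finset.univ.filter fun i => 1 - α < I.b i).card ≤
      packLength p + (Finset.univ.filter fun i => I.a i < α).card := by
  classical
  set F : Finset (Fin n) := {i | I.a i < α} with hF
  set H : Finset (Fin n) := {i | 1 - α < I.b i} with hH
  have memF : ∀ {i}, i ∈ F ↔ I.a i < α := by simp [hF]
  have memH : ∀ {i}, i ∈ H ↔ 1 - α < I.b i := by simp [hH]
  rcases le_or_gt α (1 / 2) with hα | hα
  · rw [packLength_eq_card_add_ends]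
    have hsub : H.image (fun i => p i + 1) \ F.image p ⊆
        Finset.univ.image (fun i => p i + 1) \ Finset.univ.image p := by
      intro k hk
      simp only [Finset.mem_sdiff, Finset.mem_image, Finset.mem_univ, true_and, not_exists,
        not_and] at hk ⊢
      obtain ⟨⟨i, hi, rfl⟩, hk⟩ := hk
      refine ⟨⟨i, rfl⟩, fun j hj => hk j ?_ hj⟩
      have := hp.chain hj.symm
      have := memH.1 hi
      exact memF.2 (by linarith)
    have hcard : (H.image (fun i => p i + 1)).card = H.card := by
      refine Finset.card_image_of_injOn fun x hx y hy hxy => ?_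
      by_contra hne
      have := (hp.adj hne (Nat.succ_injective hxy)).2.2
      linarith [memH.1 hx, memH.1 hy]
    have h1 := Finset.card_le_card hsub
    have h2 := Finset.le_card_sdiff (F.image p) (H.image (fun i => p i + 1))
    have h3 : (F.image p).card ≤ F.card := Finset.card_image_le
    omega
  · rw [packLength_eq_card_add_starts]
    have hsub : Fᶜ.image p \ Hᶜ.image (fun i => p i + 1) ⊆
        Finset.univ.image p \ Finset.univ.image (fun i => p i + 1) := by
      intro k hk
      simp only [Finset.mem_sdiff, Finset.mem_image, Finset.mem_univ, true_and, not_exists,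
        not_and, Finset.mem_compl] at hk ⊢
      obtain ⟨⟨i, hi, rfl⟩, hk⟩ := hk
      refine ⟨⟨i, rfl⟩, fun j hj => hk j ?_ hj⟩
      have := hp.chain hj
      rw [memF] at hi
      rw [memH]
      linarith
    have hcard : (Fᶜ.image p).card = Fᶜ.card := by
      refine Finset.card_image_of_injOn fun x hx y hy hxy => ?_
      by_contra hne
      have := (hp.adj hne hxy).2.1
      simp only [Finset.coe_compl, Set.mem_compl_iff, Finset.mem_coe, memF] at hx hy
      linarith
    have h1 := Finset.card_le_card hsub
    have h2 := Finset.le_card_sdiff (Hᶜ.image (fun i => p i + 1)) (Fᶜ.image p)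
    have h3 : (Hᶜ.image (fun i => p i + 1)).card ≤ Hᶜ.card := Finset.card_image_le
    have h4 := Finset.card_compl_add_card H
    have h5 := Finset.card_compl_add_card F
    rw [Fintype.card_fin] at h4 h5
    omega

theorem opt_mem (I : BigCharts n) : ∃ p : Fin n → ℕ, I.IsPacking p ∧ packLength p = I.opt :=
  Nat.sInf_mem (s := {L | ∃ p : Fin n → ℕ, I.IsPacking p ∧ packLength p = L})
    (I.exists_isPacking.elim fun p hp => ⟨_, p, hp, rfl⟩)

theorem IsMatchingPacking.packLength_add_le (hp : I.IsMatchingPacking p) {q : Fin n → ℕ}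
    (hq : I.IsPacking q) :
    packLength p ≤ 2 * (Finset.univ.image q).card := by
  obtain ⟨-, M, hM, hmax, hMp⟩ := hp
  have h1 := card_image_add_ncard_le hM hMp
  have h2 := packLength_le_two_mul_card_image p
  have h3 := card_le_card_image_add_pairing (I := I) (p := q) fun i j => hq.adj
  have h4 := hmax _ (pairing_isMatching fun i j => hq.adj)
  omega

theorem IsApp.isPacking (hp : I.IsApp p) : I.IsPacking p := by
  obtain ⟨pg, pm, hg, hm, rfl | rfl, -⟩ := hp
  · exact hg.isPacking
  · exact hm.1

theorem IsApp.three_mul_packLength_le (hp : I.IsApp p) :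
    3 * packLength p ≤ 4 * I.opt + 2 := by
  obtain ⟨pg, pm, hg, hm, -, hlen⟩ := hp
  obtain ⟨q, hq, hopt⟩ := I.opt_mem
  rcases Nat.eq_zero_or_pos n with rfl | hn
  · have : packLength pg = 0 := by simp [packLength]
    omega
  · have : NeZero n := ⟨hn.ne'⟩
    obtain ⟨α, hα⟩ := hg.exists_deficiency
    have h1 := hq.card_image_add_le α
    have h2 := hm.packLength_add_le hq
    have h3 := hq.card_le_packLength
    omega

end BigCharts
end TwoBar

namespace TwoBar
namespace BigCharts

variable {n : ℕ} {I : BigCharts n} {p : Fin n → ℕ}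

/-! ## Maximum matchings by a greedy method -/

/-- `f` exchanges the two ends of every edge of a matching of the charts of `A` and fixes all other
charts. -/
structure IsPartner (I : BigCharts n) (A : Finset (Fin n)) (f : Fin n → Fin n) : Prop where
  inv : ∀ i, f (f i) = i
  adj : ∀ i, f i ≠ i → I.pairGraph.Adj i (f i)
  mem : ∀ i, f i ≠ i → i ∈ A

/-- The charts moved by `f`. -/
def moved (f : Fin n → Fin n) : Finset (Fin n) := {i | f i ≠ i}

theorem mem_moved {f : Fin n → Fin n} {i : Fin n} : i ∈ moved f ↔ f i ≠ i := by simp [moved]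

/-- Every matching exceeds some matching of the charts of `A` by at most `m` edges. -/
def MatchingBound (I : BigCharts n) (A : Finset (Fin n)) (m : ℕ) : Prop :=
  ∀ f, I.IsPartner Finset.univ f →
    ∃ g, I.IsPartner A g ∧ (moved f).card ≤ (moved g).card + 2 * m

theorem matchingBound_univ (I : BigCharts n) : I.MatchingBound Finset.univ 0 :=
  fun f hf => ⟨f, hf, le_rfl⟩

/-- If `j` and `u` are matched to `x` and `y`, then `x` and `y` are adjacent: `a x ≤ a u` by the
choice of `u`, and `b y ≤ b j` by the choice of `j`. Hence deleting `j` and `u` costs at most one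
edge. -/
theorem IsPartner.exchange {A : Finset (Fin n)} {f : Fin n → Fin n} (hf : I.IsPartner A f)
    {j u : Fin n} (hj : ∀ i ∈ A, I.b i ≤ I.b j) (hju : I.pairGraph.Adj j u)
    (hu : ∀ i ∈ A, I.pairGraph.Adj j i → I.a i ≤ I.a u) :
    ∃ g, I.IsPartner ((A.erase j).erase u) g ∧ (moved f).card ≤ (moved g).card + 2 := by
  classical
  obtain ⟨inv, adj, mem⟩ := hf
  have hne : j ≠ u := hju.ne
  have key : ∀ x, f x = j → x ≠ j → ∀ y, f y = u → y ≠ u → x ≠ y →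
      I.pairGraph.Adj x y := by
    intro x hx hxj y hy hyu hxy
    have h1 := adj x (by rw [hx]; exact hxj.symm)
    have h2 := adj y (by rw [hy]; exact hyu.symm)
    rw [hx] at h1
    rw [hy] at h2
    have h3 := hu x (mem x (by rw [hx]; exact hxj.symm)) h1.symm
    have h4 := hj y (mem y (by rw [hy]; exact hyu.symm))
    exact ⟨hxy, by linarith [h2.2.1], by linarith [h1.2.2]⟩
  -- `g` fixes `j` and `u` and joins their former partners, if both exist.
  set g : Fin n → Fin n := fun x => if x = j ∨ x = u then x else
    if f x = j then (if f u = u then x else f u) else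
    if f x = u then (if f j = j then x else f j) else f x with hg
  have hinj : ∀ x y, f x = f y → x = y := fun x y h => by rw [← inv x, h, inv]
  refine ⟨g, ⟨?_, ?_, ?_⟩, ?_⟩
  · intro x
    have := inv x; have := inv j; have := inv u
    simp only [hg]
    grind
  · intro x hx
    simp only [hg] at hx ⊢
    have := inv x; have := inv j; have := inv u
    split_ifs at hx ⊢ with h1 h2 h3 h4 h5
    · exact absurd rfl hx
    · exact absurd rfl hx
    · exact key x h2 (by tauto) (f u) (inv u) h3 hx.symm
    · exact absurd rfl hx
    · exact (key (f j) (inv j) h5 x h4 (by tauto) hx).symm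
    · exact adj x hx
  · intro x hx
    simp only [Finset.mem_erase]
    simp only [hg] at hx
    refine ⟨?_, ?_, mem x ?_⟩ <;> grind
  -- `T` covers the charts that lose their partner for good.
  · set T : Finset (Fin n) := if f j = j then {u, f u} else if f u = u then {j, f j} else {j, u}
      with hT
    have hTc : T.card ≤ 2 := by
      rw [hT]; split_ifs <;> exact Finset.card_le_two
    have hsub : moved f ⊆ moved g ∪ T := by
      intro x hx
      rw [mem_moved] at hx
      rw [Finset.mem_union, mem_moved]
      have := inv x; have := inv j; have := inv u
      by_contra hno
      push Not at hno
      simp only [hg, hT] at hno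
      grind
    have := (Finset.card_le_card hsub).trans (Finset.card_union_le _ _)
    omega

theorem MatchingBound.pair {A : Finset (Fin n)} {m : ℕ} (h : I.MatchingBound A m) {j u : Fin n}
    (hj : ∀ i ∈ A, I.b i ≤ I.b j) (hju : I.pairGraph.Adj j u)
    (hu : ∀ i ∈ A, I.pairGraph.Adj j i → I.a i ≤ I.a u) :
    I.MatchingBound ((A.erase j).erase u) (m + 1) := by
  intro f hf
  obtain ⟨g, hg, h1⟩ := h f hf
  obtain ⟨g', hg', h2⟩ := hg.exchange hj hju hu
  exact ⟨g', hg', by omega⟩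

theorem MatchingBound.single {A : Finset (Fin n)} {m : ℕ} (h : I.MatchingBound A m) {j : Fin n}
    (hj : ∀ i ∈ A, ¬ I.pairGraph.Adj j i) : I.MatchingBound (A.erase j) m := by
  intro f hf
  obtain ⟨g, hg, h1⟩ := h f hf
  refine ⟨g, ⟨hg.inv, hg.adj, fun i hi => Finset.mem_erase.2 ⟨?_, hg.mem i hi⟩⟩, h1⟩
  rintro rfl
  exact hj _ (hg.mem (g i) (by rw [hg.inv]; exact hi.symm)) (hg.adj i hi)

/-- On no charts `g` is the identity, so the involution of `M` moves at most `2 * m` charts, two for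
each edge. -/
theorem MatchingBound.ncard_edgeSet_le {m : ℕ} (h : I.MatchingBound ∅ m)
    {M : I.pairGraph.Subgraph} (hM : M.IsMatching) : M.edgeSet.ncard ≤ m := by
  classical
  set f : Fin n → Fin n := fun i => if h : i ∈ M.verts then (hM h).choose else i with hf
  have hadj : ∀ {i j}, M.Adj i j → f i = j := by
    intro i j hij
    have hi := hij.fst_mem
    simp only [hf, hi, ↓reduceDIte]
    exact ((hM hi).choose_spec.2 j hij).symm
  have hadj' : ∀ {i}, f i ≠ i → M.Adj i (f i) := by
    intro i hi
    by_cases hv : i ∈ M.verts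
    · simp only [hf, hv, ↓reduceDIte]
      exact (hM hv).choose_spec.1
    · simp [hf, hv] at hi
  have inv : ∀ i, f (f i) = i := by
    intro i
    by_cases hi : f i = i
    · rw [hi, hi]
    · exact hadj (M.symm.symm _ _ (hadj' hi))
  obtain ⟨g, hg, hc⟩ := h f ⟨inv, fun i hi => M.adj_sub (hadj' hi), fun i _ => Finset.mem_univ i⟩
  have hg0 : (moved g).card = 0 := by
    rw [Finset.card_eq_zero, Finset.eq_empty_iff_forall_notMem]
    intro i hi
    exact absurd (hg.mem i (mem_moved.1 hi)) (Finset.notMem_empty i)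
  set S : Finset (Fin n) := {i | f i < i} with hS
  set S' : Finset (Fin n) := {i | i < f i} with hS'
  have h1 : M.edgeSet.ncard ≤ S.card := by
    refine BigCharts.ncard_edgeSet_le hM S fun i j hij h => ?_
    rw [hS, Finset.mem_filter, hadj (M.symm.symm _ _ h)]
    exact ⟨Finset.mem_univ j, hij⟩
  have h2 : S.card ≤ S'.card := by
    refine Finset.card_le_card_of_injOn f (fun i hi => ?_) fun i _ j _ hij => ?_
    · simp only [hS, hS', Finset.coe_filter, Finset.mem_univ, true_and, Set.mem_ofPred_eq] at hi ⊢
      rwa [inv]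
    · rw [← inv i, hij, inv]
  have h3 : S.card + S'.card ≤ (moved f).card := by
    rw [← Finset.card_union_of_disjoint]
    · refine Finset.card_le_card fun i hi => ?_
      simp only [hS, hS', Finset.mem_union, Finset.mem_filter, Finset.mem_univ, true_and] at hi
      exact mem_moved.2 (hi.elim (fun h => h.ne) fun h => h.ne')
    · rw [Finset.disjoint_left]
      intro i hi hi'
      simp only [hS, hS', Finset.mem_filter, Finset.mem_univ, true_and] at hi hi'
      exact hi.asymm hi'
  omega

theorem sum_fiber_le_one (f : Fin n → ℝ) (hf : ∀ i, f i ≤ 1) {q : Fin n → ℕ}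
    (hq : ∀ i j, i ≠ j → q i = q j → f i + f j ≤ 1)
    (huniq : ∀ i j k, i ≠ j → i ≠ k → q i = q j → q i = q k → j = k) (k : ℕ) :
    ∑ i with q i = k, f i ≤ 1 := by
  classical
  by_cases h : ∃ i, q i = k
  · obtain ⟨i, rfl⟩ := h
    by_cases h' : ∃ j, i ≠ j ∧ q i = q j
    · obtain ⟨j, hij, hj⟩ := h'
      have : (Finset.univ.filter fun x => q x = q i) = {i, j} := by
        ext x
        simp only [Finset.mem_filter, Finset.mem_univ, true_and, Finset.mem_insert,
          Finset.mem_singleton]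
        constructor
        · intro hx
          by_cases hxi : x = i
          · exact Or.inl hxi
          · exact Or.inr (huniq i x j (Ne.symm hxi) hij hx.symm hj)
        · rintro (rfl | rfl)
          exacts [rfl, hj.symm]
      rw [this, Finset.sum_pair hij]
      exact hq i j hij hj
    · push Not at h'
      have : (Finset.univ.filter fun x => q x = q i) = {i} := by
        ext x
        simp only [Finset.mem_filter, Finset.mem_univ, true_and, Finset.mem_singleton]
        constructor
        · intro hx
          by_contra hxi
          exact h' x (Ne.symm hxi) hx.symm
        · rintro rfl; rfl
      rw [this, Finset.sum_singleton]
      exact hf i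
  · push Not at h
    rw [Finset.filter_false_of_mem fun i _ => h i, Finset.sum_empty]
    exact zero_le_one

/-- Odd bins receive only first bars and even bins only second bars, at most two each because no
three charts are pairwise adjacent. -/
theorem isPacking_of_odd (hodd : ∀ i, Odd (p i)) (hlt : ∀ i, p i ≤ 2 * n - 1)
    (hadj : ∀ i j, i ≠ j → p i = p j → I.pairGraph.Adj i j) : I.IsPacking p := by
  refine ⟨fun i => ⟨(hodd i).pos, hlt i⟩, fun k _ => ?_⟩
  have uniq : ∀ i j k, i ≠ j → i ≠ k → p i = p j → p i = p k → j = k :=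
    fun i j k hij hik hj hk => pairGraph_adj_unique (hadj i j hij hj) (hadj i k hik hk)
      fun hne => hadj j k hne (hj.symm.trans hk)
  rcases Nat.even_or_odd k with hk | hk
  · rw [Finset.filter_false_of_mem fun i _ hi => ?_, Finset.sum_empty, zero_add]
    · exact sum_fiber_le_one I.b I.b_le_one
        (fun i j hij h => (hadj i j hij (Nat.succ_injective h)).2.2)
        (fun i j k hij hik hj hk =>
          uniq i j k hij hik (Nat.succ_injective hj) (Nat.succ_injective hk)) k
    · have := hodd i
      grind
  · rw [Finset.filter_false_of_mem (p := fun i => p i + 1 = k) fun i _ hi => ?_,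
      Finset.sum_empty, add_zero]
    · exact sum_fiber_le_one I.a I.a_le_one (fun i j hij h => (hadj i j hij h).2.1) uniq k
    · have := hodd i
      grind

theorem isMatchingPacking_of_odd {m : ℕ} (hodd : ∀ i, Odd (p i)) (hlt : ∀ i, p i ≤ 2 * n - 1)
    (hadj : ∀ i j, i ≠ j → p i = p j → I.pairGraph.Adj i j) (hm : I.MatchingBound ∅ m)
    (hcard : (Finset.univ.image p).card + m ≤ n) : I.IsMatchingPacking p := by
  refine ⟨isPacking_of_odd hodd hlt hadj, I.pairing p hadj, pairing_isMatching hadj,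
    fun M' hM' => ?_, fun i j h => h.2⟩
  have h1 := hm.ncard_edgeSet_le hM'
  have h2 := card_le_card_image_add_pairing hadj
  omega

/-! ## Runs of the greedy procedure -/

/-- Chart `i` precedes chart `j` in the list of Algorithm GALO, when identical charts are listed
in the order of their numbers. -/
def Before (I : BigCharts n) (i j : Fin n) : Prop :=
  I.a j < I.a i ∨ (I.a j = I.a i ∧ (I.b j < I.b i ∨ (I.b j = I.b i ∧ i < j)))

theorem exists_sorted_list (I : BigCharts n) :
    ∃ l : List (Fin n), l.Perm (List.finRange n) ∧ l.Pairwise I.Before := by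
  classical
  -- Insertion sort is applied to a total relation, hence the reflexive closure; distinctness of the
  -- entries then removes equality.
  let r : Fin n → Fin n → Prop := fun i j => I.Before i j ∨ i = j
  have : Std.Total r := ⟨fun i j => by
    simp only [r, Before]
    rcases lt_trichotomy (I.a i) (I.a j) with h | h | h <;>
      rcases lt_trichotomy (I.b i) (I.b j) with h' | h' | h' <;>
      rcases lt_trichotomy i j with h'' | h'' | h'' <;> grind⟩
  have : IsTrans (Fin n) r := ⟨fun i j k => by
    simp only [r, Before]
    grind⟩
  refine ⟨(List.finRange n).insertionSort r, List.perm_insertionSort _ _, ?_⟩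
  have h1 := List.pairwise_insertionSort r (List.finRange n)
  have h2 : ((List.finRange n).insertionSort r).Nodup :=
    (List.perm_insertionSort r _).nodup_iff.2 (List.nodup_finRange n)
  exact h1.imp₂ (fun i j h h' => h.resolve_right h') h2

/-- The program keeps a set `U` of used charts instead of a list. The `Before`-first fitting chart
outside `U` is the one the list procedure takes. -/
theorem GaloRun.place_filter {l : List (Fin n)} (hl : l.Pairwise I.Before) (hmem : ∀ i, i ∈ l)
    {U : Finset (Fin n)} {k : ℕ} {r : ℝ} {i : Fin n} (hi : i ∉ U) (hfit : r + I.a i ≤ 1)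
    (hfirst : ∀ j ∉ U, r + I.a j ≤ 1 → ¬ I.Before j i) (hp : p i = k)
    (h : I.GaloRun (k + 1) (I.b i) (l.filter (· ∉ insert i U)) p) :
    I.GaloRun k r (l.filter (· ∉ U)) p := by
  have hi' : i ∈ l.filter (· ∉ U) := List.mem_filter.2 ⟨hmem i, by simpa using hi⟩
  obtain ⟨l₁, l₂, hsplit⟩ := List.append_of_mem hi'
  have hs : (l₁ ++ i :: l₂).Pairwise I.Before := hsplit ▸ hl.filter _
  have hirr : ∀ x, ¬ I.Before x x := by intro x; simp [Before]
  have h1 : ∀ j ∈ l₁, I.Before j i := fun j hj =>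
    (List.pairwise_append.1 hs).2.2 j hj i (by simp)
  have h2 : ∀ j ∈ l₂, I.Before i j := fun j hj =>
    List.rel_of_pairwise_cons (List.pairwise_append.1 hs).2.1 hj
  have heq : l.filter (· ∉ insert i U) = l₁ ++ l₂ := by
    have : l.filter (· ∉ insert i U) = (l.filter (· ∉ U)).filter (· ≠ i) := by
      rw [List.filter_filter]
      congr 1
      funext x
      simp [Finset.mem_insert]
    rw [this, hsplit, List.filter_append, List.filter_cons]
    simp only [ne_eq, not_true_eq_false, decide_false, Bool.false_eq_true, ↓reduceIte]
    rw [List.filter_eq_self.2, List.filter_eq_self.2]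
    · intro x hx
      have := h2 x hx
      simp only [decide_not, Bool.not_eq_eq_eq_not, Bool.not_true, decide_eq_false_iff_not]
      rintro rfl
      exact hirr _ this
    · intro x hx
      have := h1 x hx
      simp only [decide_not, Bool.not_eq_eq_eq_not, Bool.not_true, decide_eq_false_iff_not]
      rintro rfl
      exact hirr _ this
  rw [heq] at h
  rw [hsplit]
  refine GaloRun.place k r l₁ i l₂ p (fun j hj hr => ?_) hfit hp h
  have hjU : j ∈ l.filter (· ∉ U) := by rw [hsplit]; simp [hj]
  exact hfirst j (by simpa using (List.mem_filter.1 hjU).2) hr (h1 j hj)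

/-- Each step of a run is forced; with `next_inv` this computes GALO's result on a concrete list. -/
theorem GaloRun.place_inv {k : ℕ} {r : ℝ} {l₁ l₂ : List (Fin n)} {i : Fin n}
    (hno : ∀ j ∈ l₁, ¬ r + I.a j ≤ 1) (hi : r + I.a i ≤ 1)
    (h : I.GaloRun k r (l₁ ++ i :: l₂) p) :
    p i = k ∧ I.GaloRun (k + 1) (I.b i) (l₁ ++ l₂) p := by
  generalize hl : l₁ ++ i :: l₂ = l at h
  cases h with
  | done => simp at hl
  | next _ _ _ _ _ hno' _ => exact absurd hi (hno' i (by simp [← hl]))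
  | place _ _ m₁ j m₂ _ hno' hj hpj h' =>
    rcases List.append_eq_append_iff.1 hl with ⟨t, rfl, ht⟩ | ⟨t, rfl, ht⟩
    · rcases t with _ | ⟨x, t⟩
      · simp only [List.nil_append, List.cons.injEq] at ht
        obtain ⟨rfl, rfl⟩ := ht
        rw [List.append_nil] at h'
        exact ⟨hpj, h'⟩
      · simp only [List.cons_append, List.cons.injEq] at ht
        obtain ⟨rfl, rfl⟩ := ht
        exact absurd hi (hno' i (by simp))
    · rcases t with _ | ⟨x, t⟩
      · simp only [List.nil_append, List.cons.injEq] at ht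
        obtain ⟨rfl, rfl⟩ := ht
        simpa using ⟨hpj, h'⟩
      · simp only [List.cons_append, List.cons.injEq] at ht
        obtain ⟨rfl, rfl⟩ := ht
        exact absurd hj (hno j (by simp))

theorem GaloRun.next_inv {k : ℕ} {r : ℝ} {l : List (Fin n)} (hne : l ≠ [])
    (hno : ∀ j ∈ l, ¬ r + I.a j ≤ 1) (h : I.GaloRun k r l p) : I.GaloRun (k + 1) 0 l p := by
  cases h with
  | done => exact absurd rfl hne
  | next _ _ _ _ _ _ h => exact h
  | place _ _ m₁ j m₂ _ _ hj _ _ => exact absurd hj (hno j (by simp))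

/-! ## The tight instance -/

/-- Four charts for which the bound is attained. -/
noncomputable def tight : BigCharts 4 where
  a := ![6 / 10, 3 / 10, 2 / 10, 1 / 10]
  b := ![1 / 10, 7 / 10, 1, 7 / 10]
  a_nonneg i := by fin_cases i <;> norm_num
  b_nonneg i := by fin_cases i <;> norm_num
  a_le_one i := by fin_cases i <;> norm_num
  b_le_one i := by fin_cases i <;> norm_num
  big i := by fin_cases i <;> norm_num

theorem tight_pos (i : Fin 4) : 0 < tight.a i ∧ 0 < tight.b i := by
  fin_cases i <;> norm_num [tight]

theorem tight_opt : tight.opt = 4 := by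
  apply le_antisymm
  -- The loads of bins 1 to 4 are 0.9, 0.9, 0.9 and 1.
  · refine Nat.sInf_le ⟨![1, 1, 3, 2], ⟨fun i => ?_, fun k hk => ?_⟩, by decide⟩
    · fin_cases i <;> simp
    · rw [Finset.mem_Icc] at hk
      obtain ⟨h1, h2⟩ := hk
      simp only [Finset.sum_filter, Fin.sum_univ_four, tight]
      interval_cases k <;> simp <;> norm_num
  · obtain ⟨p, hp, h⟩ := tight.opt_mem
    rw [← h]
    exact hp.card_le_packLength

/-- Chart 2 lands in bin 3 and its second bar fills bin 4, which pushes chart 3 to bins 5 and 6. -/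
theorem tight_galo {p : Fin 4 → ℕ} (hp : tight.IsGalo p) : packLength p = 6 := by
  obtain ⟨l, hl, hs, h⟩ := hp
  have hs' : ([0, 1, 2, 3] : List (Fin 4)).Pairwise tight.LexGE := by
    simp [LexGE, tight]
    norm_num
  have hleq : l = [0, 1, 2, 3] := by
    refine List.Perm.eq_of_pairwise (le := tight.LexGE) ?_ hs hs' (hl.trans (by decide))
    intro i j _ _
    fin_cases i <;> fin_cases j <;> simp [LexGE, tight] <;> norm_num
  subst hleq
  obtain ⟨h0, h⟩ := GaloRun.place_inv (l₁ := []) (by simp) (by simp [tight]; try norm_num) h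
  obtain ⟨h1, h⟩ := GaloRun.place_inv (l₁ := []) (by simp) (by simp [tight]; try norm_num) h
  obtain ⟨h2, h⟩ := GaloRun.place_inv (l₁ := []) (by simp) (by simp [tight]; try norm_num) h
  have h := GaloRun.next_inv (by simp) (by simp [tight]; try norm_num) h
  obtain ⟨h3, -⟩ := GaloRun.place_inv (l₁ := []) (by simp) (by simp [tight]; try norm_num) h
  have : p = ![1, 2, 3, 5] := by
    funext i
    fin_cases i <;> simp [h0, h1, h2, h3]
  rw [this]
  decide

/-- Charts 1, 2, 3 have second bars of at least 0.7, hence three positions, each costing two bins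
when all are odd. Oddness is essential: the optimal packing of length 4 also pairs a maximum
matching. -/
theorem tight_matching {p : Fin 4 → ℕ} (hp : tight.IsPacking p) (hodd : ∀ i, Odd (p i)) :
    6 ≤ packLength p := by
  rw [packLength_of_odd hodd]
  have hne : ∀ i j, i ≠ 0 → j ≠ 0 → i ≠ j → p i ≠ p j := by
    intro i j hi hj hij h
    have := (hp.adj hij h).2.2
    fin_cases i <;> fin_cases j <;> simp_all [tight] <;> norm_num at this
  have h3 : (Finset.image p {1, 2, 3}).card = 3 := by
    rw [Finset.card_image_of_injOn]
    · rfl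
    · intro i hi j hj hij
      by_contra hne'
      refine hne i j ?_ ?_ hne' hij
      · rintro rfl; simp at hi
      · rintro rfl; simp at hj
  have := Finset.card_le_card (Finset.image_subset_image (f := p)
    (Finset.subset_univ ({1, 2, 3} : Finset (Fin 4))))
  omega

end BigCharts
end TwoBar

namespace TwoBar

/-! ## Total correctness of programs with a bound on the number of steps -/

/-- Started in memory `s`, program `c` halts after at most `t` steps in a memory satisfying `Q`. -/
def Ends (c : Cmd) (s : Mem) (t : ℕ) (Q : Mem → Prop) : Prop :=
  ∃ t' s', Run c s t' s' ∧ t' ≤ t ∧ Q s'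

/-- Assignment to a natural variable. -/
def Mem.putN (s : Mem) (x v : ℕ) : Mem := { s with nvar := Function.update s.nvar x v }

/-- Assignment to an entry of a natural array. -/
def Mem.putNA (s : Mem) (A i v : ℕ) : Mem :=
  { s with narr := Function.update s.narr A (Function.update (s.narr A) i v) }

/-- Assignment to a real variable. -/
def Mem.putR (s : Mem) (x : ℕ) (v : ℝ) : Mem := { s with rvar := Function.update s.rvar x v }

namespace Mem

variable (s : Mem) (x v A i y j B : ℕ) (w : ℝ)

@[simp] theorem putN_nvar : (s.putN x v).nvar y = if y = x then v else s.nvar y := by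
  simp [putN, Function.update_apply]
@[simp] theorem putN_narr : (s.putN x v).narr = s.narr := rfl
@[simp] theorem putN_rvar : (s.putN x v).rvar = s.rvar := rfl
@[simp] theorem putNA_nvar : (s.putNA A i v).nvar = s.nvar := rfl
@[simp] theorem putNA_narr :
    (s.putNA A i v).narr B j = if B = A ∧ j = i then v else s.narr B j := by
  by_cases h : B = A
  · subst h; simp [putNA, Function.update_apply]
  · simp [putNA, h]
@[simp] theorem putNA_rarr : (s.putNA A i v).rarr = s.rarr := rfl
@[simp] theorem putR_nvar : (s.putR x w).nvar = s.nvar := rfl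
@[simp] theorem putR_narr : (s.putR x w).narr = s.narr := rfl
@[simp] theorem putR_rvar : (s.putR x w).rvar y = if y = x then w else s.rvar y := by
  simp [putR, Function.update_apply]

end Mem

namespace Ends

variable {c d : Cmd} {s : Mem} {t t₁ t₂ : ℕ} {Q Q' : Mem → Prop}

theorem mono (h : Ends c s t Q) (hQ : ∀ s', Q s' → Q' s') : Ends c s t Q' := by
  obtain ⟨t', s', hr, ht, hq⟩ := h
  exact ⟨t', s', hr, ht, hQ s' hq⟩

theorem mono_time (h : Ends c s t₁ Q) (ht : t₁ ≤ t₂) : Ends c s t₂ Q := by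
  obtain ⟨t', s', hr, ht', hq⟩ := h
  exact ⟨t', s', hr, ht'.trans ht, hq⟩

theorem skip (h : Q s) : Ends Cmd.skip s 1 Q := ⟨1, s, Run.skip s, le_rfl, h⟩

theorem setN {x : ℕ} {e : NExp} (h : Q (s.putN x (e.eval s))) : Ends (Cmd.setN x e) s 1 Q :=
  ⟨1, _, Run.setN x e s, le_rfl, h⟩

theorem storeN {A : ℕ} {i e : NExp} (h : Q (s.putNA A (i.eval s) (e.eval s))) :
    Ends (Cmd.storeN A i e) s 1 Q :=
  ⟨1, _, Run.storeN A i e s, le_rfl, h⟩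

theorem setR {x : ℕ} {e : RExp} (h : Q (s.putR x (e.eval s))) : Ends (Cmd.setR x e) s 1 Q :=
  ⟨1, _, Run.setR x e s, le_rfl, h⟩

theorem seq (h : Ends c s t₁ fun s₁ => Ends d s₁ t₂ Q) : Ends (Cmd.seq c d) s (t₁ + t₂) Q := by
  obtain ⟨t', s', hr, ht, t'', s'', hr', ht', hq⟩ := h
  exact ⟨t' + t'', s'', Run.seq hr hr', add_le_add ht ht', hq⟩

theorem ite {b : BExp} (h₁ : b.Holds s → Ends c s t Q) (h₂ : ¬ b.Holds s → Ends d s t Q) :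
    Ends (Cmd.ite b c d) s (t + 1) Q := by
  by_cases hb : b.Holds s
  · obtain ⟨t', s', hr, ht, hq⟩ := h₁ hb
    exact ⟨t' + 1, s', Run.iteTrue hb hr, by omega, hq⟩
  · obtain ⟨t', s', hr, ht, hq⟩ := h₂ hb
    exact ⟨t' + 1, s', Run.iteFalse hb hr, by omega, hq⟩

end Ends

/-- `body` for the values `0, …, n - 1` of variable `X`, where `n` is the value of variable `0`. -/
def Cmd.forAll (X : ℕ) (body : Cmd) : Cmd :=
  .seq (.setN X (.const 0))
    (.loop (.nle (.succ (.var X)) (.var 0)) (.seq body (.setN X (.succ (.var X)))))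

/-- Each round costs the body, the increment and the test; the last `2` pays for the initialization
and the failing test. -/
theorem Ends.forAll {X : ℕ} {body : Cmd} {t n : ℕ} {s : Mem} {Q : Mem → Prop} (hX : X ≠ 0)
    (Inv : ℕ → Mem → Prop) (hn : s.nvar 0 = n) (h0 : Inv 0 (s.putN X 0))
    (hstep : ∀ i s, i < n → Inv i s → s.nvar X = i → s.nvar 0 = n →
      Ends body s t fun s' => s'.nvar X = i ∧ s'.nvar 0 = n ∧ Inv (i + 1) (s'.putN X (i + 1)))
    (hQ : ∀ s, s.nvar 0 = n → Inv n s → Q s) :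
    Ends (Cmd.forAll X body) s (n * (t + 2) + 2) Q := by
  have key : ∀ m i s, i + m = n → Inv i s → s.nvar X = i → s.nvar 0 = n →
      Ends (.loop (.nle (.succ (.var X)) (.var 0)) (.seq body (.setN X (.succ (.var X))))) s
        (m * (t + 2) + 1) Q := by
    intro m
    induction m with
    | zero =>
      intro i s hi hInv hXi hs
      obtain rfl : i = n := by omega
      refine ⟨1, s, Run.loopFalse ?_, by omega, hQ s hs hInv⟩
      simp [BExp.Holds, NExp.eval, hXi, hs]
    | succ m ih =>
      intro i s hi hInv hXi hs
      obtain ⟨t', s', hr, ht, h1, h2, h3⟩ := hstep i s (by omega) hInv hXi hs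
      obtain ⟨t'', s'', hr', ht', hq⟩ := ih (i + 1) (s'.putN X (i + 1)) (by omega) h3 (by simp)
        (by simp [hX.symm, h2])
      refine ⟨t' + 1 + t'' + 1, s'', Run.loopTrue ?_ (Run.seq hr (Run.setN X _ s')) ?_, ?_, hq⟩
      · simp only [BExp.Holds, NExp.eval, hXi, hs]; omega
      · simpa [NExp.eval, h1, Mem.putN] using hr'
      · have : (m + 1) * (t + 2) = m * (t + 2) + (t + 2) := by ring
        omega
  refine Ends.mono_time (Ends.seq (Ends.setN ?_)) (t₁ := 1 + (n * (t + 2) + 1)) (by omega)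
  exact key n 0 _ (by omega) h0 (by simp [NExp.eval]) (by simp [hX.symm, hn])

/-! ## The search for a best index -/

/-- Put into variable `B` an index `X` satisfying `cand` that is best according to `better`, which
tells whether `X` is better than `B`, or `n` if there is no such index. -/
def Cmd.argmax (X B : ℕ) (cand better : BExp) : Cmd :=
  .seq (.setN B (.var 0)) (.forAll X (.ite cand
    (.ite (.nle (.var 0) (.var B)) (.setN B (.var X)) (.ite better (.setN B (.var X)) .skip))
    .skip))

/-- The memories `s` and `s'` differ at most in the variables `X` and `B`. -/
structure Mem.Frame (X B : ℕ) (s s' : Mem) : Prop where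
  nvar : ∀ y, y ≠ X → y ≠ B → s'.nvar y = s.nvar y
  narr : s'.narr = s.narr
  rvar : s'.rvar = s.rvar
  rarr : s'.rarr = s.rarr

/-- `v` is a best index, or `n` if there is no candidate. -/
def IsBest (n : ℕ) (Cand : ℕ → Prop) (R : ℕ → ℕ → Prop) (v : ℕ) : Prop :=
  (v = n ∧ ∀ y < n, ¬ Cand y) ∨ (v < n ∧ Cand v ∧ ∀ y < n, Cand y → ¬ R v y)

theorem Ends.argmax {X B n : ℕ} {cand better : BExp} {s : Mem} {Cand : ℕ → Prop}
    {R : ℕ → ℕ → Prop} (hX : X ≠ 0) (hB : B ≠ 0) (hXB : X ≠ B) (hn : s.nvar 0 = n)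
    (hirr : ∀ x, ¬ R x x) (htrans : ∀ x y z, R x y → R y z → R x z)
    (hcand : ∀ s', s.Frame X B s' → (cand.Holds s' ↔ Cand (s'.nvar X)))
    (hbetter : ∀ s', s.Frame X B s' → (better.Holds s' ↔ R (s'.nvar B) (s'.nvar X))) :
    Ends (Cmd.argmax X B cand better) s (6 * n + 3) fun s' =>
      s.Frame X B s' ∧ IsBest n Cand R (s'.nvar B) := by
  refine Ends.mono_time (Ends.seq (Ends.setN ?_)) (t₁ := 1 + (n * (4 + 2) + 2)) (by omega)
  refine Ends.forAll hX (fun i s' => s.Frame X B s' ∧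
    ((s'.nvar B = n ∧ ∀ y < i, ¬ Cand y) ∨
      (s'.nvar B < n ∧ Cand (s'.nvar B) ∧ ∀ y < i, Cand y → ¬ R (s'.nvar B) y)))
    (by simp [hB.symm, hn]) ?_ ?_ fun s' _ h => h
  · refine ⟨⟨fun y h1 h2 => by simp [h1, h2], rfl, rfl, rfl⟩, Or.inl ⟨?_, by simp⟩⟩
    simp [hXB.symm, NExp.eval, hn]
  · rintro i s' hi ⟨hf, h⟩ hXi hs'
    have hupd : s.Frame X B ((s'.putN B i).putN X (i + 1)) :=
      ⟨fun y h1 h2 => by simp [h1, h2, hf.nvar], hf.narr, hf.rvar, hf.rarr⟩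
    have hkeep : s.Frame X B (s'.putN X (i + 1)) :=
      ⟨fun y h1 h2 => by simp [h1, hf.nvar y h1 h2], hf.narr, hf.rvar, hf.rarr⟩
    refine Ends.ite (fun hc => Ends.ite (t := 2) (fun h0 => ?_) fun h0 => Ends.ite (fun hb => ?_)
      fun hb => ?_) fun hc => Ends.mono_time (Ends.skip ?_) (by omega)
    · rw [hcand s' hf, hXi] at hc
      refine Ends.mono_time (Ends.setN ?_) (by omega)
      simp only [BExp.Holds, NExp.eval, hs'] at h0
      simp only [NExp.eval, hXi]
      refine ⟨by simp [hXB, hXi], by simp [hB.symm, hs'], hupd, Or.inr ?_⟩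
      simp only [Mem.putN_nvar, hXB.symm, ↓reduceIte]
      refine ⟨hi, hc, fun y hy hy' => ?_⟩
      rcases h with ⟨_, h⟩ | ⟨h, _⟩
      · obtain rfl : y = i := by
          by_contra hne
          exact h y (by omega) hy'
        exact hirr y
      · omega
    · rw [hcand s' hf, hXi] at hc
      rw [hbetter s' hf, hXi] at hb
      refine Ends.setN ?_
      simp only [BExp.Holds, NExp.eval, hs'] at h0
      simp only [NExp.eval, hXi]
      refine ⟨by simp [hXB, hXi], by simp [hB.symm, hs'], hupd, Or.inr ?_⟩
      simp only [Mem.putN_nvar, hXB.symm, ↓reduceIte]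
      refine ⟨hi, hc, fun y hy hy' hR => ?_⟩
      rcases h with ⟨h, _⟩ | ⟨_, _, h⟩
      · omega
      · by_cases hyi : y = i
        · subst hyi; exact hirr y hR
        · exact h y (by omega) hy' (htrans _ _ _ hb hR)
    · rw [hbetter s' hf, hXi] at hb
      simp only [BExp.Holds, NExp.eval, hs'] at h0
      refine Ends.skip ⟨hXi, hs', hkeep, Or.inr ?_⟩
      simp only [Mem.putN_nvar, hXB.symm, ↓reduceIte]
      rcases h with ⟨h, _⟩ | ⟨h, h', h''⟩
      · omega
      · refine ⟨h, h', fun y hy hy' => ?_⟩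
        by_cases hyi : y = i
        · subst hyi; exact hb
        · exact h'' y (by omega) hy'
    · rw [hcand s' hf, hXi] at hc
      refine ⟨hXi, hs', hkeep, ?_⟩
      simp only [Mem.putN_nvar, hXB.symm, ↓reduceIte]
      rcases h with ⟨h, h'⟩ | ⟨h, h', h''⟩
      · refine Or.inl ⟨h, fun y hy => ?_⟩
        by_cases hyi : y = i
        · subst hyi; exact hc
        · exact h' y (by omega)
      · refine Or.inr ⟨h, h', fun y hy hy' => ?_⟩
        by_cases hyi : y = i
        · subst hyi; exact absurd hy' hc
        · exact h'' y (by omega) hy'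

/-! ## The program for GALO -/

/-- Disjunction. -/
def BExp.or (c d : BExp) : BExp := .not (.and (.not c) (.not d))

/-- Strict comparison of reals. -/
def BExp.rlt (e f : RExp) : BExp := .not (.rle f e)

theorem BExp.holds_or {c d : BExp} {s : Mem} : (c.or d).Holds s ↔ c.Holds s ∨ d.Holds s := by
  simp only [BExp.or, BExp.Holds]; tauto

theorem BExp.holds_rlt {e f : RExp} {s : Mem} : (BExp.rlt e f).Holds s ↔ e.eval s < f.eval s := by
  simp [BExp.rlt, BExp.Holds]

/-- Find the first chart of GALO's list that fits into the current bin: variable `1` runs through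
the charts, variable `2` receives the result, real variable `0` holds the height occupied in the
current bin, and the nonzero entries of array `1` mark the charts already packed. -/
def galoPick : Cmd :=
  .argmax 1 2
    (.and (.nle (.arr 1 (.var 1)) (.const 0))
      (.rle (.add (.var 0) (.arr 0 (.var 1))) (.const 1)))
    (.and (.rle (.arr 0 (.var 2)) (.arr 0 (.var 1)))
      (.or (.rlt (.arr 0 (.var 2)) (.arr 0 (.var 1)))
        (.and (.rle (.arr 1 (.var 2)) (.arr 1 (.var 1)))
          (.or (.rlt (.arr 1 (.var 2)) (.arr 1 (.var 1)))
            (.nle (.succ (.var 1)) (.var 2))))))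

/-- Place the next chart: variable `4` holds the current bin, array `2` the positions. -/
def galoStep : Cmd :=
  .seq galoPick (.seq
    (.ite (.nle (.var 0) (.var 2))
      (.seq (.setN 4 (.succ (.var 4))) (.seq (.setR 0 (.const 0)) galoPick)) .skip)
    (.seq (.storeN 2 (.var 2) (.var 4)) (.seq (.storeN 1 (.var 2) (.const 1))
      (.seq (.setR 0 (.arr 1 (.var 2))) (.setN 4 (.succ (.var 4)))))))

/-- Algorithm GALO. -/
def galoProg : Cmd := .seq (.setN 4 (.const 1)) (.forAll 3 galoStep)

/-! ### Correctness and running time of the GALO program -/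

namespace BigCharts

variable {n : ℕ} {I : BigCharts n}

theorem inputMem_a (I : BigCharts n) (i : Fin n) : I.inputMem.rarr 0 i = I.a i := by
  simp [inputMem]

theorem inputMem_b (I : BigCharts n) (i : Fin n) : I.inputMem.rarr 1 i = I.b i := by
  simp [inputMem]

/-- The memory during GALO, when the charts of `U` have been taken from the list `l`. -/
structure GaloState (I : BigCharts n) (l : List (Fin n)) (U : Finset (Fin n)) (s : Mem) :
    Prop where
  size : s.nvar 0 = n
  input : s.rarr = I.inputMem.rarr
  fresh : ∀ y, s.narr 3 y = 0
  used : ∀ x : Fin n, s.narr 1 x = 0 ↔ x ∉ U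
  -- Continuation form: a run from the current state on the remaining list, with any `p` extending
  -- the stored positions, completes to a run from the start.
  run : ∀ p : Fin n → ℕ, (∀ x ∈ U, p x = s.narr 2 x) →
    I.GaloRun (s.nvar 4) (s.rvar 0) (l.filter (· ∉ U)) p → I.GaloRun 1 0 l p
  one_le : ∀ x ∈ U, 1 ≤ s.narr 2 x
  le : ∀ x ∈ U, s.narr 2 x + 1 ≤ s.nvar 4
  pos : 1 ≤ s.nvar 4
  bins : ∀ m, 1 ≤ m → m < s.nvar 4 → ∃ x ∈ U, s.narr 2 x = m ∨ s.narr 2 x + 1 = m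

/-- The current bin is the one after the bin of the first bar placed last. -/
structure GaloLast (U : Finset (Fin n)) (s : Mem) : Prop where
  init : U = ∅ → s.rvar 0 = 0
  last : U.Nonempty → ∃ x ∈ U, s.narr 2 x + 1 = s.nvar 4

theorem GaloState.frame {l : List (Fin n)} {U : Finset (Fin n)} {s s' : Mem}
    (h : I.GaloState l U s) (hf : s.Frame 1 2 s') : I.GaloState l U s' := by
  obtain ⟨h1, h2, h3, h4, h5, h6, h7, h8, h9⟩ := h
  have e0 := hf.nvar 0 (by norm_num) (by norm_num)
  have e4 := hf.nvar 4 (by norm_num) (by norm_num)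
  rw [← hf.narr] at h3 h4 h5 h6 h7 h9
  rw [← hf.rvar] at h5
  rw [← e4] at h5 h7 h8 h9
  exact ⟨e0.trans h1, hf.rarr.trans h2, h3, h4, h5, h6, h7, h8, h9⟩

theorem GaloLast.frame {U : Finset (Fin n)} {s s' : Mem} (h : GaloLast U s)
    (hf : s.Frame 1 2 s') : GaloLast U s' := by
  have e4 := hf.nvar 4 (by norm_num) (by norm_num)
  exact ⟨by rw [hf.rvar]; exact h.init, by rw [hf.narr, e4]; exact h.last⟩

/-- `x` is the first chart of the list outside `U` that fits. -/
structure IsFirst (I : BigCharts n) (U : Finset (Fin n)) (r : ℝ) (x : Fin n) : Prop where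
  notMem : x ∉ U
  fits : r + I.a x ≤ 1
  first : ∀ j ∉ U, r + I.a j ≤ 1 → ¬ I.Before j x

theorem GaloState.pick {l : List (Fin n)} {U : Finset (Fin n)} {s : Mem}
    (h : I.GaloState l U s) :
    Ends galoPick s (6 * n + 3) fun s' => s.Frame 1 2 s' ∧
      ((s'.nvar 2 = n ∧ ∀ j ∉ U, ¬ s'.rvar 0 + I.a j ≤ 1) ∨
        ∃ x : Fin n, s'.nvar 2 = x ∧ I.IsFirst U (s'.rvar 0) x) := by
  refine Ends.mono (Ends.argmax (Cand := fun y => s.narr 1 y = 0 ∧ s.rvar 0 + s.rarr 0 y ≤ 1)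
    -- This is "`y` is `Before` `v`" with equalities replaced by non-strict comparisons.
    (R := fun v y => s.rarr 0 v ≤ s.rarr 0 y ∧ (s.rarr 0 v < s.rarr 0 y ∨
      (s.rarr 1 v ≤ s.rarr 1 y ∧ (s.rarr 1 v < s.rarr 1 y ∨ y < v))))
    (by norm_num) (by norm_num) (by norm_num) h.size ?_ ?_ ?_ ?_) ?_
  · intro x; simp
  · intro x y z; grind
  · intro s' hf
    simp [BExp.Holds, NExp.eval, RExp.eval, hf.narr, hf.rvar, hf.rarr]
  · intro s' hf
    simp only [BExp.holds_or, BExp.holds_rlt, BExp.Holds, NExp.eval, RExp.eval, hf.rarr,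
      Nat.succ_le_iff]
  · rintro s' ⟨hf, hb⟩
    refine ⟨hf, ?_⟩
    rw [hf.rvar]
    rcases hb with ⟨h1, h2⟩ | ⟨h1, ⟨h2, h3⟩, h4⟩
    · refine Or.inl ⟨h1, fun j hj hr => h2 j j.isLt ⟨(h.used j).2 hj, ?_⟩⟩
      rw [h.input, inputMem_a]; exact hr
    · refine Or.inr ⟨⟨s'.nvar 2, h1⟩, rfl, (h.used ⟨s'.nvar 2, h1⟩).1 h2, ?_, ?_⟩
      · rw [h.input] at h3
        rwa [← inputMem_a]
      · intro j hj hr hbef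
        refine h4 j j.isLt ⟨(h.used j).2 hj, by rw [h.input, inputMem_a]; exact hr⟩ ?_
        simp only [Before, ← inputMem_a, ← inputMem_b] at hbef
        rw [h.input]
        rcases hbef with hb | ⟨hb, hb' | ⟨hb', hb''⟩⟩
        · exact ⟨hb.le, Or.inl hb⟩
        · exact ⟨hb.le, Or.inr ⟨hb'.le, Or.inl hb'⟩⟩
        · exact ⟨hb.le, Or.inr ⟨hb'.le, Or.inr hb''⟩⟩

theorem exists_notMem_of_card_lt {U : Finset (Fin n)} (hU : U.card < n) : ∃ x, x ∉ U := by
  by_contra hall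
  push Not at hall
  rw [Finset.eq_univ_of_forall hall, Finset.card_univ, Fintype.card_fin] at hU
  exact absurd hU (lt_irrefl n)

/-- The skipped bin is not empty: it holds the second bar of the chart placed last, so `bins`
survives. `GaloLast` does not survive, which is why it is kept separate. -/
theorem GaloState.next {l : List (Fin n)} (hmem : ∀ i, i ∈ l) {U : Finset (Fin n)} {s : Mem}
    (h : I.GaloState l U s) (hlast : GaloLast U s) (hU : U.card < n)
    (hno : ∀ j ∉ U, ¬ s.rvar 0 + I.a j ≤ 1) :
    I.GaloState l U ((s.putN 4 (s.nvar 4 + 1)).putR 0 0) := by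
  obtain ⟨x, hx⟩ := exists_notMem_of_card_lt hU
  have hne : U.Nonempty := by
    by_contra hemp
    rw [Finset.not_nonempty_iff_eq_empty] at hemp
    have := hno x hx
    rw [hlast.init hemp, zero_add] at this
    exact this (I.a_le_one x)
  refine ⟨by simpa using h.size, h.input, h.fresh, h.used, fun p hp hrun => ?_, h.one_le,
    fun x hx => ?_, by simp, fun m h1 hm => ?_⟩
  · refine h.run p hp (GaloRun.next _ _ _ _ ?_ ?_ (by simpa using hrun))
    · exact List.ne_nil_of_mem (List.mem_filter.2 ⟨hmem x, by simpa using hx⟩)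
    · intro j hj
      exact hno j (by simpa using (List.mem_filter.1 hj).2)
  · have := h.le x hx
    simp only [Mem.putR_narr, Mem.putN_narr, Mem.putR_nvar, Mem.putN_nvar, ↓reduceIte]
    omega
  · simp only [Mem.putR_narr, Mem.putN_narr, Mem.putR_nvar, Mem.putN_nvar, ↓reduceIte] at hm ⊢
    by_cases hmk : m < s.nvar 4
    · exact h.bins m h1 hmk
    · obtain ⟨y, hy, hy'⟩ := hlast.last hne
      exact ⟨y, hy, Or.inr (by omega)⟩

theorem GaloState.place {l : List (Fin n)} (hl : l.Pairwise I.Before) (hmem : ∀ i, i ∈ l)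
    {U : Finset (Fin n)} {s : Mem} (h : I.GaloState l U s) {x : Fin n}
    (hx : I.IsFirst U (s.rvar 0) x) :
    I.GaloState l (insert x U) ((((s.putNA 2 x (s.nvar 4)).putNA 1 x 1).putR 0 (I.b x)).putN 4
        (s.nvar 4 + 1)) ∧
      GaloLast (insert x U) ((((s.putNA 2 x (s.nvar 4)).putNA 1 x 1).putR 0 (I.b x)).putN 4
        (s.nvar 4 + 1)) := by
  have hne : ∀ y ∈ U, (y : ℕ) ≠ x := fun y hy hyx => hx.notMem (Fin.ext hyx ▸ hy)
  refine ⟨⟨by simpa using h.size, h.input, fun y => by simpa using h.fresh y, fun y => ?_,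
    fun p hp hrun => ?_, fun y hy => ?_, fun y hy => ?_, by simp, fun m h1 hm => ?_⟩,
    fun hemp => absurd hemp (Finset.insert_ne_empty x U), fun _ =>
      ⟨x, Finset.mem_insert_self x U, by simp⟩⟩
  · have := h.used y
    by_cases hyx : y = x
    · simp [hyx]
    · simp [hyx, this, Fin.val_inj]
  · simp only [Mem.putN_narr, Mem.putR_narr, Mem.putNA_narr, OfNat.ofNat_ne_one, false_and,
      if_false, true_and] at hp
    refine h.run p (fun y hy => ?_) (GaloRun.place_filter hl hmem hx.notMem hx.fits hx.first ?_
      (by simpa using hrun))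
    · rw [hp y (Finset.mem_insert_of_mem hy), if_neg (hne y hy)]
    · rw [hp x (Finset.mem_insert_self x U), if_pos rfl]
  · rcases Finset.mem_insert.1 hy with rfl | hy
    · simpa using h.pos
    · simpa [hne y hy] using h.one_le y hy
  · rcases Finset.mem_insert.1 hy with rfl | hy
    · simp
    · have := h.le y hy
      simp [hne y hy]
      omega
  · simp only [Mem.putN_nvar, ↓reduceIte] at hm
    by_cases hmk : m < s.nvar 4
    · obtain ⟨y, hy, hy'⟩ := h.bins m h1 hmk
      exact ⟨y, Finset.mem_insert_of_mem hy, by simpa [hne y hy] using hy'⟩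
    · refine ⟨x, Finset.mem_insert_self x U, Or.inl ?_⟩
      simp
      omega

/-- Two linear searches suffice per chart, since after a skip the bin is empty and accepts anything.
-/
theorem galoStep_ends {l : List (Fin n)} (hl : l.Pairwise I.Before) (hmem : ∀ i, i ∈ l)
    {U : Finset (Fin n)} {s : Mem} (h : I.GaloState l U s) (hlast : GaloLast U s)
    (hU : U.card < n) :
    Ends galoStep s (12 * n + 13) fun s' => s'.nvar 3 = s.nvar 3 ∧
      ∃ x ∉ U, I.GaloState l (insert x U) s' ∧ GaloLast (insert x U) s' := by
  refine Ends.mono_time (Ends.seq (h.pick.mono ?_))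
    (t₁ := 6 * n + 3 + ((6 * n + 5 + 1) + 4)) (by omega)
  rintro s₁ ⟨hf, hpick⟩
  have h₁ := h.frame hf
  refine Ends.seq (Ends.mono (Q := fun s₂ => s₂.nvar 3 = s.nvar 3 ∧ I.GaloState l U s₂ ∧
    ∃ x : Fin n, s₂.nvar 2 = x ∧ I.IsFirst U (s₂.rvar 0) x) ?_ ?_)
  · refine Ends.ite (fun hb => ?_) fun hb => Ends.mono_time (Ends.skip ?_) (by omega)
    · have hno : ∀ j ∉ U, ¬ s₁.rvar 0 + I.a j ≤ 1 := by
        rcases hpick with ⟨-, hno⟩ | ⟨x, hx, -⟩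
        · exact hno
        · simp only [BExp.Holds, NExp.eval, h₁.size, hx] at hb
          have := x.isLt
          omega
      have h₂ := h₁.next hmem (hlast.frame hf) hU hno
      refine Ends.mono_time (Ends.seq (Ends.setN (Ends.seq (Ends.setR ?_))))
        (t₁ := 1 + (1 + (6 * n + 3))) (by omega)
      simp only [NExp.eval, RExp.eval, Rat.cast_zero]
      refine h₂.pick.mono ?_
      rintro s₃ ⟨hf', hpick'⟩
      refine ⟨?_, h₂.frame hf', ?_⟩
      · rw [hf'.nvar 3 (by norm_num) (by norm_num)]
        simpa using hf.nvar 3 (by norm_num) (by norm_num)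
      · rcases hpick' with ⟨-, hno'⟩ | hx
        · obtain ⟨x, hx⟩ := exists_notMem_of_card_lt hU
          have := hno' x hx
          rw [hf'.rvar] at this
          simp only [Mem.putR_rvar, ↓reduceIte, zero_add] at this
          exact absurd (I.a_le_one x) this
        · exact hx
    · refine ⟨hf.nvar 3 (by norm_num) (by norm_num), h₁, ?_⟩
      rcases hpick with ⟨hn, -⟩ | hx
      · simp [BExp.Holds, NExp.eval, h₁.size, hn] at hb
      · exact hx
  · rintro s₂ ⟨e3, h₂, x, hx, hfirst⟩
    refine Ends.seq (t₁ := 1) (t₂ := 3) (Ends.storeN (Ends.seq (t₁ := 1) (t₂ := 2)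
      (Ends.storeN (Ends.seq (Ends.setR (Ends.setN ?_))))))
    have hb : s₂.rarr 1 x = I.b x := by rw [h₂.input, inputMem_b]
    simp only [NExp.eval, RExp.eval, Mem.putNA_nvar, Mem.putNA_rarr, Mem.putR_nvar, hx, hb]
    exact ⟨by simpa using e3, x, hfirst.notMem, h₂.place hl hmem hfirst⟩

theorem packLength_eq_of_bins {p : Fin n → ℕ} {k : ℕ} (h1 : ∀ x, 1 ≤ p x)
    (h2 : ∀ x, p x + 1 ≤ k) (h3 : ∀ m, 1 ≤ m → m ≤ k → ∃ x, p x = m ∨ p x + 1 = m) :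
    packLength p = k := by
  have : Finset.univ.image p ∪ Finset.univ.image (fun i => p i + 1) = Finset.Icc 1 k := by
    ext m
    simp only [Finset.mem_union, Finset.mem_image, Finset.mem_univ, true_and, Finset.mem_Icc]
    constructor
    · rintro (⟨x, rfl⟩ | ⟨x, rfl⟩)
      · exact ⟨h1 x, by have := h2 x; omega⟩
      · exact ⟨by omega, h2 x⟩
    · rintro ⟨hm, hm'⟩
      obtain ⟨x, hx | hx⟩ := h3 m hm hm'
      · exact Or.inl ⟨x, hx⟩
      · exact Or.inr ⟨x, hx⟩
  rw [packLength, this, Nat.card_Icc, Nat.add_sub_cancel]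

/-- The memory after GALO. -/
structure GaloDone (I : BigCharts n) (s : Mem) : Prop where
  size : s.nvar 0 = n
  input : s.rarr = I.inputMem.rarr
  isGalo : I.IsGalo fun x => s.narr 2 x
  -- For `n = 0` the bin counter is `1` although the length is `0`.
  length : n ≠ 0 → packLength (fun x : Fin n => s.narr 2 x) = s.nvar 4

theorem galoProg_ends (I : BigCharts n) :
    Ends galoProg I.inputMem (n * (12 * n + 15) + 3) fun s =>
      I.GaloDone s ∧ ∀ y, s.narr 3 y = 0 := by
  obtain ⟨l, hperm, hl⟩ := I.exists_sorted_list
  have hmem : ∀ i, i ∈ l := fun i => hperm.mem_iff.2 (List.mem_finRange i)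
  refine Ends.mono_time (Ends.seq (Ends.setN (Ends.forAll (n := n) (t := 12 * n + 13)
    (by norm_num) (fun i s => ∃ U : Finset (Fin n), U.card = i ∧ I.GaloState l U s ∧ GaloLast U s)
    ?_ ?_ ?_ ?_))) (by linarith)
  · simp [inputMem]
  · refine ⟨∅, rfl, ⟨by simp [inputMem], rfl, fun _ => rfl, fun x => by simp [inputMem],
      fun p _ hrun => ?_, by simp, by simp, by simp [NExp.eval], ?_⟩, ⟨fun _ => rfl, by simp⟩⟩
    · simpa [NExp.eval, inputMem] using hrun
    · intro m h1 h2
      simp [NExp.eval] at h2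
      omega
  · rintro i s hi ⟨U, rfl, h, hlast⟩ h3 hn
    refine (galoStep_ends hl hmem h hlast hi).mono ?_
    rintro s' ⟨e3, x, hx, h', hlast'⟩
    refine ⟨e3.trans h3, h'.size, insert x U, Finset.card_insert_of_notMem hx, ?_, ?_⟩
    · exact ⟨by simpa using h'.size, h'.input, h'.fresh, h'.used, h'.run, h'.one_le, h'.le, h'.pos,
        h'.bins⟩
    · exact ⟨hlast'.init, hlast'.last⟩
  · rintro s hn ⟨U, hU, h, hlast⟩
    have hU : U = Finset.univ := by
      rw [← Finset.card_eq_iff_eq_univ, hU, Fintype.card_fin]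
    subst hU
    refine ⟨⟨hn, h.input, ⟨l, hperm, ?_, ?_⟩, fun h0 => ?_⟩, h.fresh⟩
    · refine hl.imp fun {i j} hij => ?_
      rcases hij with h | ⟨h, h' | h'⟩
      · exact Or.inl h
      · exact Or.inr ⟨h, h'.le⟩
      · exact Or.inr ⟨h, h'.1.le⟩
    · refine h.run _ (fun _ _ => rfl) ?_
      rw [List.filter_eq_nil_iff.2 (by simp)]
      exact GaloRun.done _ _ _
    · have : NeZero n := ⟨h0⟩
      refine packLength_eq_of_bins (fun x => h.one_le x (Finset.mem_univ x))
        (fun x => h.le x (Finset.mem_univ x)) fun m h1 hm => ?_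
      rcases hm.lt_or_eq with hm | rfl
      · obtain ⟨x, -, hx⟩ := h.bins m h1 hm
        exact ⟨x, hx⟩
      · obtain ⟨x, -, hx⟩ := hlast.last Finset.univ_nonempty
        exact ⟨x, Or.inr hx⟩

end BigCharts
end TwoBar

namespace TwoBar

/-! ## The program for Matching -/

/-- Take the remaining chart (array `3` marks those already placed) with the highest second bar
into variable `2`. -/
def matchPick : Cmd :=
  .argmax 1 2 (.nle (.arr 3 (.var 1)) (.const 0)) (.rlt (.arr 1 (.var 2)) (.arr 1 (.var 1)))

/-- Take the remaining chart adjacent to that of variable `2` with the highest first bar into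
variable `5`. -/
def partnerPick : Cmd :=
  .argmax 1 5
    (.and (.nle (.arr 3 (.var 1)) (.const 0))
      (.and (.rle (.add (.arr 0 (.var 2)) (.arr 0 (.var 1))) (.const 1))
        (.rle (.add (.arr 1 (.var 2)) (.arr 1 (.var 1))) (.const 1))))
    (.rlt (.arr 0 (.var 5)) (.arr 0 (.var 1)))

/-- Place the next chart, together with a partner if there is one: variable `6` holds the next
position, array `4` the positions. -/
def matchStep : Cmd :=
  .seq matchPick (.ite (.nle (.var 0) (.var 2)) .skip
    (.seq (.storeN 4 (.var 2) (.var 6)) (.seq (.storeN 3 (.var 2) (.const 1))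
      (.seq partnerPick (.seq
        (.ite (.nle (.var 0) (.var 5)) .skip
          (.seq (.storeN 4 (.var 5) (.var 6)) (.storeN 3 (.var 5) (.const 1))))
        (.setN 6 (.succ (.succ (.var 6)))))))))

/-- Algorithm Matching; the charts without a partner are packed into two bins of their own. -/
def matchProg : Cmd := .seq (.setN 6 (.const 1)) (.forAll 3 matchStep)

/-- Copy array `A` to the output. -/
def copyProg (A : ℕ) : Cmd := .forAll 1 (.storeN 0 (.var 1) (.arr A (.var 1)))

/-- Algorithm App. -/
def appProg : Cmd :=
  .seq galoProg (.seq matchProg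
    (.ite (.nle (.succ (.var 4)) (.var 6)) (copyProg 2) (copyProg 4)))

/-! ### Correctness and running time of the Matching and App programs -/

namespace BigCharts

variable {n : ℕ} {I : BigCharts n}

/-- The memory during Matching, when the charts of `D` are placed at the first `t` odd positions,
`m` of them together with another one. -/
structure MatchState (I : BigCharts n) (D : Finset (Fin n)) (t m : ℕ) (s : Mem) : Prop where
  galo : I.GaloDone s
  placed : ∀ x : Fin n, s.narr 3 x = 0 ↔ x ∉ D
  next : s.nvar 6 = 2 * t + 1
  card : D.card = t + m
  bound : I.MatchingBound Dᶜ m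
  pos : ∀ x ∈ D, ∃ c < t, s.narr 4 x = 2 * c + 1
  occupied : ∀ c < t, ∃ x ∈ D, s.narr 4 x = 2 * c + 1
  adj : ∀ x ∈ D, ∀ y ∈ D, x ≠ y → s.narr 4 x = s.narr 4 y → I.pairGraph.Adj x y

theorem GaloDone.congr {s s' : Mem} (h : I.GaloDone s) (h0 : s'.nvar 0 = s.nvar 0)
    (h4 : s'.nvar 4 = s.nvar 4) (h2 : ∀ y, s'.narr 2 y = s.narr 2 y) (hr : s'.rarr = s.rarr) :
    I.GaloDone s' := by
  refine ⟨h0.trans h.size, hr.trans h.input, ?_, ?_⟩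
  · simpa only [h2] using h.isGalo
  · simpa only [h2, h4] using h.length

theorem GaloDone.frame {s s' : Mem} {B : ℕ} (h : I.GaloDone s) (hB : B = 2 ∨ B = 5)
    (hf : s.Frame 1 B s') : I.GaloDone s' :=
  h.congr (hf.nvar 0 (by norm_num) (by omega)) (hf.nvar 4 (by norm_num) (by omega))
    (fun y => by rw [hf.narr]) hf.rarr

theorem MatchState.frame {s s' : Mem} {B : ℕ} {D : Finset (Fin n)} {t m : ℕ}
    (h : I.MatchState D t m s) (hB : B = 2 ∨ B = 5) (hf : s.Frame 1 B s') :
    I.MatchState D t m s' := by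
  obtain ⟨h1, h2, h3, h4, h5, h6, h7, h8⟩ := h
  rw [← hf.narr] at h2 h6 h7 h8
  exact ⟨h1.frame hB hf, h2, (hf.nvar 6 (by norm_num) (by omega)).trans h3, h4, h5, h6, h7, h8⟩

theorem matchPick_ends {s : Mem} (hn : s.nvar 0 = n) (hr : s.rarr = I.inputMem.rarr)
    {D : Finset (Fin n)} (hD : ∀ x : Fin n, s.narr 3 x = 0 ↔ x ∉ D) :
    Ends matchPick s (6 * n + 3) fun s' => s.Frame 1 2 s' ∧
      ((s'.nvar 2 = n ∧ D = Finset.univ) ∨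
        ∃ x ∉ D, s'.nvar 2 = x ∧ ∀ y ∉ D, I.b y ≤ I.b x) := by
  refine Ends.mono (Ends.argmax (Cand := fun y => s.narr 3 y = 0)
    (R := fun v y => s.rarr 1 v < s.rarr 1 y)
    (by norm_num) (by norm_num) (by norm_num) hn (by simp) (fun x y z h h' => h.trans h')
    ?_ ?_) ?_
  · intro s' hf
    simp [BExp.Holds, NExp.eval, hf.narr]
  · intro s' hf
    simp only [BExp.holds_rlt, NExp.eval, RExp.eval, hf.rarr]
  · rintro s' ⟨hf, hb⟩
    refine ⟨hf, ?_⟩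
    rcases hb with ⟨h1, h2⟩ | ⟨h1, h2, h3⟩
    · refine Or.inl ⟨h1, Finset.eq_univ_of_forall fun x => ?_⟩
      by_contra hx
      exact h2 x x.isLt ((hD x).2 hx)
    · refine Or.inr ⟨⟨s'.nvar 2, h1⟩, (hD ⟨s'.nvar 2, h1⟩).1 h2, rfl, fun y hy => ?_⟩
      have := h3 y y.isLt ((hD y).2 hy)
      simp only [hr, inputMem_b, not_lt] at this
      rwa [← inputMem_b I ⟨s'.nvar 2, h1⟩]

theorem partnerPick_ends {s : Mem} (hn : s.nvar 0 = n) (hr : s.rarr = I.inputMem.rarr)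
    {D : Finset (Fin n)} (hD : ∀ x : Fin n, s.narr 3 x = 0 ↔ x ∉ D) {j : Fin n} (hj : j ∈ D)
    (hj2 : s.nvar 2 = j) :
    Ends partnerPick s (6 * n + 3) fun s' => s.Frame 1 5 s' ∧
      ((s'.nvar 5 = n ∧ ∀ y ∉ D, ¬ I.pairGraph.Adj j y) ∨
        ∃ x ∉ D, s'.nvar 5 = x ∧ I.pairGraph.Adj j x ∧
          ∀ y ∉ D, I.pairGraph.Adj j y → I.a y ≤ I.a x) := by
  refine Ends.mono (Ends.argmax (Cand := fun y => s.narr 3 y = 0 ∧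
      s.rarr 0 j + s.rarr 0 y ≤ 1 ∧ s.rarr 1 j + s.rarr 1 y ≤ 1)
    (R := fun v y => s.rarr 0 v < s.rarr 0 y)
    (by norm_num) (by norm_num) (by norm_num) hn (by simp) (fun x y z h h' => h.trans h')
    ?_ ?_) ?_
  · intro s' hf
    have := hf.nvar 2 (by norm_num) (by norm_num)
    simp [BExp.Holds, NExp.eval, RExp.eval, hf.narr, hf.rarr, this, hj2]
  · intro s' hf
    simp only [BExp.holds_rlt, NExp.eval, RExp.eval, hf.rarr]
  · rintro s' ⟨hf, hb⟩
    refine ⟨hf, ?_⟩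
    have cand : ∀ y ∉ D, I.pairGraph.Adj j y → s.narr 3 y = 0 ∧
        s.rarr 0 j + s.rarr 0 y ≤ 1 ∧ s.rarr 1 j + s.rarr 1 y ≤ 1 := by
      intro y hy hjy
      refine ⟨(hD y).2 hy, ?_⟩
      rw [hr, inputMem_a, inputMem_a, inputMem_b, inputMem_b]
      exact hjy.2
    rcases hb with ⟨h1, h2⟩ | ⟨h1, ⟨h2, h2'⟩, h3⟩
    · exact Or.inl ⟨h1, fun y hy hjy => h2 y y.isLt (cand y hy hjy)⟩
    · have hx := (hD ⟨s'.nvar 5, h1⟩).1 h2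
      rw [hr, inputMem_a, inputMem_b, inputMem_a I ⟨s'.nvar 5, h1⟩,
        inputMem_b I ⟨s'.nvar 5, h1⟩] at h2'
      refine Or.inr ⟨⟨s'.nvar 5, h1⟩, hx, rfl, ⟨?_, h2'⟩, fun y hy hjy => ?_⟩
      · rintro rfl; exact hx hj
      · have := h3 y y.isLt (cand y hy hjy)
        simp only [hr, inputMem_a, not_lt] at this
        rwa [← inputMem_a I ⟨s'.nvar 5, h1⟩]

theorem MatchState.single {D : Finset (Fin n)} {t m : ℕ} {s s' : Mem}
    (h : I.MatchState D t m s) (hg : I.GaloDone s') {j : Fin n} (hj : j ∉ D)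
    (h3 : ∀ x : Fin n, s'.narr 3 x = if x = j then 1 else s.narr 3 x)
    (h4 : ∀ x : Fin n, s'.narr 4 x = if x = j then 2 * t + 1 else s.narr 4 x)
    (h6 : s'.nvar 6 = 2 * (t + 1) + 1)
    (hadj : ∀ y ∉ insert j D, ¬ I.pairGraph.Adj j y) :
    I.MatchState (insert j D) (t + 1) m s' := by
  have hne : ∀ y ∈ D, y ≠ j := fun y hy hyj => hj (hyj ▸ hy)
  have h4j : s'.narr 4 j = 2 * t + 1 := by rw [h4, if_pos rfl]
  have h4D : ∀ y ∈ D, s'.narr 4 y = s.narr 4 y := fun y hy => by rw [h4, if_neg (hne y hy)]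
  refine ⟨hg, fun x => ?_, h6, ?_, ?_, fun x hx => ?_, fun c hc => ?_, fun x hx y hy hxy he => ?_⟩
  · have := h.placed x
    rw [h3]
    split_ifs with hx
    · simp [hx]
    · simp [this, hx]
  · rw [Finset.card_insert_of_notMem hj, h.card]; omega
  · rw [Finset.compl_insert]
    refine h.bound.single fun y hy hjy => ?_
    refine hadj y ?_ hjy
    rw [Finset.mem_insert]
    rintro (rfl | hyD)
    · exact hjy.ne rfl
    · exact Finset.mem_compl.1 hy hyD
  · rcases Finset.mem_insert.1 hx with rfl | hx
    · exact ⟨t, by omega, h4j⟩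
    · obtain ⟨c, hc, hc'⟩ := h.pos x hx
      exact ⟨c, by omega, by rw [h4D x hx, hc']⟩
  · rcases Nat.lt_succ_iff_lt_or_eq.1 hc with hc | rfl
    · obtain ⟨x, hx, hx'⟩ := h.occupied c hc
      exact ⟨x, Finset.mem_insert_of_mem hx, by rw [h4D x hx, hx']⟩
    · exact ⟨j, Finset.mem_insert_self j D, h4j⟩
  · rcases Finset.mem_insert.1 hx with rfl | hx' <;>
      rcases Finset.mem_insert.1 hy with rfl | hy'
    · exact absurd rfl hxy
    · obtain ⟨c, hc, hc'⟩ := h.pos y hy'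
      rw [h4j, h4D y hy'] at he
      omega
    · obtain ⟨c, hc, hc'⟩ := h.pos x hx'
      rw [h4j, h4D x hx'] at he
      omega
    · rw [h4D x hx', h4D y hy'] at he
      exact h.adj x hx' y hy' hxy he

theorem MatchState.pair {D : Finset (Fin n)} {t m : ℕ} {s s' : Mem}
    (h : I.MatchState D t m s) (hg : I.GaloDone s') {j u : Fin n} (hj : j ∉ D) (hu : u ∉ D)
    (h3 : ∀ x : Fin n, s'.narr 3 x = if x = u ∨ x = j then 1 else s.narr 3 x)
    (h4 : ∀ x : Fin n, s'.narr 4 x = if x = u ∨ x = j then 2 * t + 1 else s.narr 4 x)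
    (h6 : s'.nvar 6 = 2 * (t + 1) + 1) (hju : I.pairGraph.Adj j u)
    (hjmax : ∀ y ∉ D, I.b y ≤ I.b j)
    (humax : ∀ y ∉ insert j D, I.pairGraph.Adj j y → I.a y ≤ I.a u) :
    I.MatchState (insert u (insert j D)) (t + 1) (m + 1) s' := by
  have huj : u ∉ insert j D := by
    rw [Finset.mem_insert]
    rintro (h | h)
    · exact hju.ne h.symm
    · exact hu h
  have hne : ∀ y ∈ D, ¬ (y = u ∨ y = j) := by
    rintro y hy (rfl | rfl)
    exacts [hu hy, hj hy]
  have h4j : ∀ x, x = u ∨ x = j → s'.narr 4 x = 2 * t + 1 := fun x hx => by rw [h4, if_pos hx]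
  have h4D : ∀ y ∈ D, s'.narr 4 y = s.narr 4 y := fun y hy => by rw [h4, if_neg (hne y hy)]
  have mem : ∀ {x}, x ∈ insert u (insert j D) → (x = u ∨ x = j) ∨ x ∈ D := by
    intro x; simp only [Finset.mem_insert]; tauto
  refine ⟨hg, fun x => ?_, h6, ?_, ?_, fun x hx => ?_, fun c hc => ?_, fun x hx y hy hxy he => ?_⟩
  · have := h.placed x
    rw [h3]
    split_ifs with hx
    · simp only [Finset.mem_insert]; tauto
    · simp only [this, Finset.mem_insert]; tauto
  · rw [Finset.card_insert_of_notMem huj, Finset.card_insert_of_notMem hj, h.card]; omega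
  · rw [Finset.compl_insert, Finset.compl_insert]
    refine h.bound.pair (fun y hy => hjmax y (Finset.mem_compl.1 hy)) hju fun y hy hjy => ?_
    refine humax y ?_ hjy
    rw [Finset.mem_insert]
    rintro (rfl | hyD)
    · exact hjy.ne rfl
    · exact Finset.mem_compl.1 hy hyD
  · rcases mem hx with hx | hx
    · exact ⟨t, by omega, h4j x hx⟩
    · obtain ⟨c, hc, hc'⟩ := h.pos x hx
      exact ⟨c, by omega, by rw [h4D x hx, hc']⟩
  · rcases Nat.lt_succ_iff_lt_or_eq.1 hc with hc | rfl
    · obtain ⟨x, hx, hx'⟩ := h.occupied c hc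
      exact ⟨x, Finset.mem_insert_of_mem (Finset.mem_insert_of_mem hx), by rw [h4D x hx, hx']⟩
    · exact ⟨u, Finset.mem_insert_self u _, h4j u (Or.inl rfl)⟩
  · rcases mem hx with hx | hx <;> rcases mem hy with hy | hy
    · rcases hx with rfl | rfl <;> rcases hy with rfl | rfl
      · exact absurd rfl hxy
      · exact hju.symm
      · exact hju
      · exact absurd rfl hxy
    · obtain ⟨c, hc, hc'⟩ := h.pos y hy
      rw [h4j x hx, h4D y hy] at he
      omega
    · obtain ⟨c, hc, hc'⟩ := h.pos x hx
      rw [h4j y hy, h4D x hx] at he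
      omega
    · rw [h4D x hx, h4D y hy] at he
      exact h.adj x hx y hy hxy he

/-- A round may place two charts, but the loop always makes `n` rounds; once all charts are placed a
round changes nothing of relevance, hence the `min`. -/
theorem matchStep_ends {D : Finset (Fin n)} {t m : ℕ} {s : Mem} (h : I.MatchState D t m s) :
    Ends matchStep s (12 * n + 13) fun s' => s'.nvar 3 = s.nvar 3 ∧
      ∃ D' t' m', I.MatchState D' t' m' s' ∧ min n (D.card + 1) ≤ D'.card := by
  refine Ends.mono_time (Ends.seq ((matchPick_ends h.galo.size h.galo.input h.placed).mono ?_))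
    (t₁ := 6 * n + 3 + ((1 + (1 + (6 * n + 3 + ((2 + 1) + 1)))) + 1)) (by omega)
  rintro s₁ ⟨hf, hpick⟩
  have h₁ := h.frame (Or.inl rfl) hf
  have e3 : s₁.nvar 3 = s.nvar 3 := hf.nvar 3 (by norm_num) (by norm_num)
  refine Ends.ite (fun hb => Ends.mono_time (Ends.skip ?_) (by omega)) fun hb => ?_
  · rcases hpick with ⟨-, rfl⟩ | ⟨x, -, hx, -⟩
    · exact ⟨e3, Finset.univ, t, m, h₁, by simp⟩
    · simp only [BExp.Holds, NExp.eval, h₁.galo.size, hx] at hb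
      have := x.isLt
      omega
  · rcases hpick with ⟨hn, -⟩ | ⟨j, hjD, hj, hjmax⟩
    · simp [BExp.Holds, NExp.eval, h₁.galo.size, hn] at hb
    refine Ends.seq (Ends.storeN (Ends.seq (Ends.storeN (Ends.seq ?_))))
    simp only [NExp.eval, Mem.putNA_nvar, hj, h₁.next]
    set s₂ := (s₁.putNA 4 j (2 * t + 1)).putNA 3 j 1 with hs₂
    have hg₂ : I.GaloDone s₂ := h₁.galo.congr rfl rfl (by simp [hs₂]) rfl
    have n3 : ∀ x : Fin n, s₂.narr 3 x = if x = j then 1 else s₁.narr 3 x := by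
      intro x; simp [hs₂, Fin.val_inj]
    have n4 : ∀ x : Fin n, s₂.narr 4 x = if x = j then 2 * t + 1 else s₁.narr 4 x := by
      intro x; simp [hs₂, Fin.val_inj]
    have hD₂ : ∀ x : Fin n, s₂.narr 3 x = 0 ↔ x ∉ insert j D := by
      intro x
      have := h₁.placed x
      rw [n3]
      split_ifs with hx
      · simp [hx]
      · simp [this, hx]
    refine (partnerPick_ends hg₂.size hg₂.input hD₂ (Finset.mem_insert_self j D) hj).mono ?_
    rintro s₃ ⟨hf₃, hpick₃⟩
    have hg₃ := hg₂.frame (Or.inr rfl) hf₃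
    have e33 : s₃.nvar 3 = s.nvar 3 :=
      (hf₃.nvar 3 (by norm_num) (by norm_num)).trans e3
    have e63 : s₃.nvar 6 = 2 * t + 1 := (hf₃.nvar 6 (by norm_num) (by norm_num)).trans h₁.next
    rw [← hf₃.narr] at n3 n4
    refine Ends.seq (Ends.ite (fun hb => Ends.mono_time (Ends.skip (Ends.setN ?_)) (by omega))
      fun hb => Ends.seq (Ends.storeN (Ends.storeN (Ends.setN ?_))))
    · rcases hpick₃ with ⟨-, hno⟩ | ⟨x, -, hx, -⟩
      · simp only [NExp.eval, e63]
        have hg₄ : I.GaloDone (s₃.putN 6 (2 * t + 1 + 1 + 1)) :=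
          hg₃.congr (by simp) (by simp) (fun _ => rfl) rfl
        refine ⟨by simpa using e33, insert j D, t + 1, m, h₁.single hg₄ hjD n3 n4 ?_ hno, ?_⟩
        · simp only [Mem.putN_nvar, ↓reduceIte]; omega
        · rw [Finset.card_insert_of_notMem hjD]; exact min_le_right _ _
      · simp only [BExp.Holds, NExp.eval, hg₃.size, hx] at hb
        have := x.isLt
        omega
    · rcases hpick₃ with ⟨hn, -⟩ | ⟨u, huD, hu, hju, humax⟩
      · simp [BExp.Holds, NExp.eval, hg₃.size, hn] at hb
      have huD' : u ∉ D := fun h => huD (Finset.mem_insert_of_mem h)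
      simp only [NExp.eval, Mem.putNA_nvar, hu, e63]
      have hg₄ : I.GaloDone (((s₃.putNA 4 u (2 * t + 1)).putNA 3 u 1).putN 6
          (2 * t + 1 + 1 + 1)) :=
        hg₃.congr (by simp) (by simp) (by simp) rfl
      refine ⟨by simpa using e33, insert u (insert j D), t + 1, m + 1,
        h₁.pair hg₄ hjD huD' (fun x => ?_) (fun x => ?_) ?_ hju hjmax humax, ?_⟩
      · simp [Fin.val_inj, n3, ite_or]
      · simp [Fin.val_inj, n4, ite_or]
      · simp only [Mem.putN_nvar, ↓reduceIte]; omega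
      · rw [Finset.card_insert_of_notMem huD, Finset.card_insert_of_notMem hjD]
        exact (min_le_right _ _).trans (by omega)

/-- The memory after GALO and Matching. -/
structure MatchDone (I : BigCharts n) (s : Mem) : Prop where
  galo : I.GaloDone s
  isMatching : I.IsMatchingPacking fun x => s.narr 4 x
  odd : ∀ x : Fin n, Odd (s.narr 4 x)
  length : packLength (fun x : Fin n => s.narr 4 x) + 1 = s.nvar 6

/-- With no chart left, `bound` says that no matching has more than `m` edges, while the `t = n - m`
positions used force at least `m` pairs. -/
theorem MatchState.done {t m : ℕ} {s : Mem} (h : I.MatchState Finset.univ t m s) :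
    I.MatchDone s := by
  have hcard : t + m = n := by rw [← h.card, Finset.card_univ, Fintype.card_fin]
  have hodd : ∀ x : Fin n, Odd (s.narr 4 x) := by
    intro x
    obtain ⟨c, -, hc⟩ := h.pos x (Finset.mem_univ x)
    exact ⟨c, hc⟩
  have himage : (Finset.univ.image fun x : Fin n => s.narr 4 x).card = t := by
    have : (Finset.univ.image fun x : Fin n => s.narr 4 x) =
        (Finset.range t).image fun c => 2 * c + 1 := by
      ext k
      simp only [Finset.mem_image, Finset.mem_univ, true_and, Finset.mem_range]
      constructor
      · rintro ⟨x, rfl⟩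
        obtain ⟨c, hc, hc'⟩ := h.pos x (Finset.mem_univ x)
        exact ⟨c, hc, hc'.symm⟩
      · rintro ⟨c, hc, rfl⟩
        obtain ⟨x, -, hx⟩ := h.occupied c hc
        exact ⟨x, hx⟩
    rw [this, Finset.card_image_of_injective _ fun x y hxy => by simpa using hxy,
      Finset.card_range]
  refine ⟨h.galo, isMatchingPacking_of_odd hodd (fun x => ?_)
    (fun x y hxy he => h.adj x (Finset.mem_univ x) y (Finset.mem_univ y) hxy he)
    (by simpa using h.bound) (by rw [himage, hcard]), hodd, ?_⟩
  · obtain ⟨c, hc, hc'⟩ := h.pos x (Finset.mem_univ x)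
    omega
  · rw [packLength_of_odd hodd, himage, h.next]

theorem matchProg_ends {s : Mem} (h : I.GaloDone s) (hfresh : ∀ y, s.narr 3 y = 0) :
    Ends matchProg s (n * (12 * n + 15) + 3) I.MatchDone := by
  refine Ends.mono_time (Ends.seq (Ends.setN (Ends.forAll (n := n) (t := 12 * n + 13)
    (by norm_num) (fun i s => ∃ D t m, i ≤ D.card ∧ I.MatchState D t m s)
    ?_ ?_ ?_ ?_))) (by linarith)
  · simpa using h.size
  · refine ⟨∅, 0, 0, le_rfl, h.congr ?_ ?_ (fun _ => rfl) rfl, ?_, ?_, rfl, ?_, ?_, ?_, ?_⟩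
    · simp
    · simp
    · simpa using fun x : Fin n => hfresh x
    · simp [NExp.eval]
    · simpa using I.matchingBound_univ
    · simp
    · simp
    · simp
  · rintro i s hi ⟨D, t, m, hc, hs⟩ h3 hn
    refine (matchStep_ends hs).mono ?_
    rintro s' ⟨e3, D', t', m', hs', hc'⟩
    refine ⟨e3.trans h3, hs'.galo.size, D', t', m', le_trans ?_ hc', ?_⟩
    · exact le_min hi (by omega)
    · obtain ⟨h1, h2, h3, h4, h5, h6, h7, h8⟩ := hs'
      exact ⟨h1.congr (by simp) (by simp) (fun _ => rfl) rfl, h2, by simpa using h3, h4, h5, h6,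
        h7, h8⟩
  · rintro s hn ⟨D, t, m, hc, hs⟩
    have hD : D = Finset.univ := by
      rw [← Finset.card_eq_iff_eq_univ, Fintype.card_fin]
      exact le_antisymm (by simpa using Finset.card_le_univ D) hc
    subst hD
    exact hs.done

theorem copyProg_ends {A : ℕ} (hA : A ≠ 0) {s : Mem} (hn : s.nvar 0 = n) :
    Ends (copyProg A) s (n * 3 + 2) fun s' => s'.output n = fun x : Fin n => s.narr A x := by
  refine Ends.forAll (n := n) (t := 1) (by norm_num)
    (fun i s' => (∀ y, s'.narr A y = s.narr A y) ∧ ∀ y < i, s'.narr 0 y = s.narr A y) hn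
    ⟨fun _ => rfl, by simp⟩ ?_ ?_
  · rintro i s' hi ⟨h1, h2⟩ h3 h4
    refine Ends.storeN ⟨h3, h4, fun y => by simp [hA, h1], fun y hy => ?_⟩
    simp only [NExp.eval, h3, h1, Mem.putN_narr, Mem.putNA_narr, true_and]
    split_ifs with hyi
    · rw [hyi]
    · exact h2 y (by omega)
  · rintro s' - ⟨-, h⟩
    funext x
    exact h x x.isLt

/-- The program for Algorithm App is correct and takes quadratic time. -/
theorem appProg_ends (I : BigCharts n) :
    Ends appProg I.inputMem (24 * n ^ 2 + 33 * n + 9) fun s =>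
      ∃ pg pm : Fin n → ℕ, I.IsGalo pg ∧ I.IsMatchingPacking pm ∧ (∀ i, Odd (pm i)) ∧
        (s.output n = pg ∨ s.output n = pm) ∧
        packLength (s.output n) = min (packLength pg) (packLength pm) := by
  refine Ends.mono_time (Ends.seq (I.galoProg_ends.mono ?_))
    (t₁ := n * (12 * n + 15) + 3 + (n * (12 * n + 15) + 3 + (n * 3 + 2 + 1))) (by linarith)
  rintro s₁ ⟨h₁, hfresh⟩
  refine Ends.seq ((matchProg_ends h₁ hfresh).mono ?_)
  intro s₂ h₂
  -- Variable `4` is GALO's length and variable `6` is Matching's length plus one. For `n = 0` the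
  -- outcome of the test is immaterial.
  have hmin : n ≠ 0 → (s₂.nvar 4 + 1 ≤ s₂.nvar 6 ↔
      packLength (fun x : Fin n => s₂.narr 2 x) ≤ packLength fun x : Fin n => s₂.narr 4 x) := by
    intro h0
    rw [h₂.galo.length h0, ← h₂.length]
    omega
  have hzero : n = 0 → ∀ p q : Fin n → ℕ, packLength p = packLength q := by
    rintro rfl p q
    rw [Subsingleton.elim p q]
  refine Ends.ite (fun hb => (copyProg_ends (n := n) (by norm_num) h₂.galo.size).mono ?_)
    fun hb => (copyProg_ends (n := n) (by norm_num) h₂.galo.size).mono ?_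
  all_goals
    intro s₃ h₃
    refine ⟨_, _, h₂.galo.isGalo, h₂.isMatching, h₂.odd, ?_, ?_⟩
    · rw [h₃]; simp
    · simp only [BExp.Holds, NExp.eval] at hb
      by_cases h0 : n = 0
      · rw [hzero h0 (s₃.output n) fun x : Fin n => s₂.narr 2 x,
          hzero h0 (fun x : Fin n => s₂.narr 4 x) fun x : Fin n => s₂.narr 2 x, min_self]
      · rw [hmin h0] at hb
        rw [h₃]
        first
        | rw [min_eq_left hb]
        | rw [min_eq_right (not_le.1 hb).le]

end BigCharts

theorem isBigO_quadratic_time :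
    (fun n : ℕ => ((24 * n ^ 2 + 33 * n + 9 : ℕ) : ℝ)) =O[Filter.atTop]
      fun n : ℕ => (n : ℝ) ^ (5 / 2 : ℝ) := by
  -- `66 = 24 + 33 + 9`, as `n` and `1` are at most `n ^ 2` for `n ≥ 1`.
  refine Asymptotics.IsBigO.of_bound 66 ?_
  filter_upwards [Filter.eventually_ge_atTop 1] with n hn
  have h1 : (1 : ℝ) ≤ n := by exact_mod_cast hn
  have h2 : (n : ℝ) ^ 2 ≤ (n : ℝ) ^ (5 / 2 : ℝ) := by
    rw [← Real.rpow_natCast]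
    exact Real.rpow_le_rpow_of_exponent_le h1 (by norm_num)
  rw [Real.norm_of_nonneg (by positivity), Real.norm_of_nonneg (by positivity)]
  push_cast
  nlinarith

end TwoBar

theorem theorem3 :
    -- every result of Algorithm App is a feasible packing within the bound
    (∀ (n : ℕ) (I : TwoBar.BigCharts n) (p : Fin n → ℕ), I.IsApp p →
      I.IsPacking p ∧ (TwoBar.packLength p : ℝ) ≤ 4 / 3 * (I.opt : ℝ) + 2 / 3) ∧
    ∃ (prog : TwoBar.Cmd) (T : ℕ → ℕ),
      -- Algorithm App can be run in time `O(n ^ 2.5)`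
      ((fun n : ℕ => (T n : ℝ)) =O[Filter.atTop] fun n : ℕ => (n : ℝ) ^ (5 / 2 : ℝ)) ∧
      (∀ (n : ℕ) (I : TwoBar.BigCharts n), ∃ (t : ℕ) (s : TwoBar.Mem),
        TwoBar.Run prog I.inputMem t s ∧ t ≤ T n ∧ I.IsApp (s.output n)) ∧
      -- the bound is attained
      ∃ (n : ℕ) (I : TwoBar.BigCharts n), (∀ i, 0 < I.a i ∧ 0 < I.b i) ∧ I.opt = 4 ∧
        ∃ (t : ℕ) (s : TwoBar.Mem),
          TwoBar.Run prog I.inputMem t s ∧ TwoBar.packLength (s.output n) = 6 := by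
  refine ⟨fun n I p hp => ⟨hp.isPacking, ?_⟩, TwoBar.appProg,
    fun n => 24 * n ^ 2 + 33 * n + 9, TwoBar.isBigO_quadratic_time, fun n I => ?_,
    4, TwoBar.BigCharts.tight, TwoBar.BigCharts.tight_pos, TwoBar.BigCharts.tight_opt, ?_⟩
  · have h : (3 * TwoBar.packLength p : ℝ) ≤ 4 * I.opt + 2 := by
      exact_mod_cast hp.three_mul_packLength_le
    linarith
  · obtain ⟨t, s, hrun, ht, pg, pm, hg, hm, -, hout, hlen⟩ := I.appProg_ends
    exact ⟨t, s, hrun, ht, pg, pm, hg, hm, hout, hlen⟩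
  · obtain ⟨t, s, hrun, -, pg, pm, hg, hm, hodd, -, hlen⟩ :=
      TwoBar.BigCharts.tight.appProg_ends
    refine ⟨t, s, hrun, ?_⟩
    rw [hlen, TwoBar.BigCharts.tight_galo hg]
    exact min_eq_left (TwoBar.BigCharts.tight_matching hm.1 hodd)
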